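/- Let $a<c<b$, $k<0$, $0\le\lambda<-k$, $m=-k-\lambda>0$, $\delta>0$, let $f:\mathbb R^2\to\mathbb R$ and let $\eta\in C^2([a,b])$ be real-valued. Let $d$ be a positive continuous function on $[a,b]$ with $d=|\eta(c)-\eta(a)|+\delta$ on $[a,a+\frac\delta2]$, $d=\delta$ on $[a+\delta,b-\delta]$ and $d=|\eta(b)-\eta(c)|+\delta$ on $[b-\frac\delta2,b]$ (each intersected with $[a,b]$), and put $$H(\eta)=\{(t,y): a\le t\le b,\ |y-\eta(t)|<d(t)\},\qquad C=\frac1m\max_{t\in[a,b]}|\eta''(t)| .$$ For a control $u:[a,b]\to\mathbb R$ consider the assumptions (A1) $k\eta(t)=f(u(t),\eta(t))$ for all $t\in[a,b]$; (A2) the function $(t,y)\mapsto f(u(t),y)$ is continuous on $H(\eta)$ and has there a continuous partial derivative with respect to $y$ (for instance, it is $C^1$ on $H(\eta)$), and $\left|\frac{\partial f(u(t),y)}{\partial y}\right|\le\lambda$ for all $(t,y)\in H(\eta)$. For $\varepsilon>0$ write $s=\sqrt{m/\varepsilon}$ and $$D=\big(e^{s(b-a)}+e^{s(c-b)}+e^{s(a-c)}\big)-\big(e^{s(a-b)}+e^{s(b-c)}+e^{s(c-a)}\big),$$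 $$Z_\varepsilon(t)=\frac1D\big(e^{s(b-t)}-e^{s(t-b)}+e^{s(t-c)}-e^{s(c-t)}\big),\qquad \hat Z_\varepsilon(t)=\frac1D\big(e^{s(t-a)}-e^{s(a-t)}+e^{s(c-t)}-e^{s(t-c)}\big),$$ $$\zeta_\varepsilon=(\eta(c)-\eta(a))\,Z_\varepsilon,\qquad \hat\zeta_\varepsilon=|\eta(b)-\eta(c)|\,\hat Z_\varepsilon,$$ $$\psi_\varepsilon(t)=\frac{\lambda|\eta(c)-\eta(a)|}{D\sqrt{m\varepsilon}}\,t\,\big(e^{s(b-t)}+e^{s(t-b)}-e^{s(c-t)}-e^{s(t-c)}\big),$$ $$v_\varepsilon(t)=-\big(\psi_\varepsilon(a)-\psi_\varepsilon(c)\big)Z_\varepsilon(t)+\big(\psi_\varepsilon(c)-\psi_\varepsilon(b)\big)\hat Z_\varepsilon(t)+\psi_\varepsilon(t).$$ Then there is $\varepsilon_0>0$ such that for every $\varepsilon\in(0,\varepsilon_0]$ and every control $u$ satisfying (A1) and (A2), the three-point problem $$\varepsilon y''+ky=f(u(t),y)\ \text{ on }[a,b],\qquad y(a)=y(c)=y(b),$$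 has exactly one solution $y_\varepsilon\in C^2([a,b])$ whose graph lies in $H(\eta)$, and for all $t\in[a,b]$ $$-v_\varepsilon(t)-\hat\zeta_\varepsilon(t)-C\varepsilon\le y_\varepsilon(t)-(\eta(t)+\zeta_\varepsilon(t))\le\hat\zeta_\varepsilon(t)+C\varepsilon\quad\text{if }\eta(c)-\eta(a)\ge0,$$ $$-\hat\zeta_\varepsilon(t)-C\varepsilon\le y_\varepsilon(t)-(\eta(t)+\zeta_\varepsilon(t))\le v_\varepsilon(t)+\hat\zeta_\varepsilon(t)+C\varepsilon\quad\text{if }\eta(c)-\eta(a)\le0.$$ Moreover, for every $\varepsilon>0$ one has $v_\varepsilon\ge0$ on $[a,b]$, with $v_\varepsilon>0$ on $[a,b]$ if $\lambda\ne0$ and $\eta(c)\ne\eta(a)$, and $v_\varepsilon(a)=v_\varepsilon(c)$. Finally, let $\chi(t)=a-t$ for $a\le t\le\frac{b+c}2$ and $\chi(t)=t-b+a-c$ for $\frac{b+c}2<t\le b$; then $\chi<0$ on $(a,b]$, and there are functions $\theta_1(\varepsilon)$, $\theta_2(\varepsilon)$, $\theta_3(t,\varepsilon)$ such that, for all $\varepsilon>0$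 and $t\in[a,b]$, $$v_\varepsilon(t)=\frac{\lambda|\eta(c)-\eta(a)|}{\sqrt{m\varepsilon}}\Big[-\theta_1(\varepsilon)Z_\varepsilon(t)+\theta_2(\varepsilon)\hat Z_\varepsilon(t)+t\,\theta_3(t,\varepsilon)\Big],$$ and, as $\varepsilon\to0^+$, $\theta_1=O(1)$, $\theta_2=O\big(e^{\sqrt{m/\varepsilon}\,(a-c)}\big)$, and $\theta_3(t,\cdot)=O\big(e^{\sqrt{m/\varepsilon}\,\chi(t)}\big)$ for each $t\in[a,b]$. These orders are exact, in the sense that the absolute value of the quotient of the two sides has a limit in $(0,\infty)$, for $\theta_1$ if $a\ne0$, for $\theta_2$ if $b+c\ne0$, and for $\theta_3(t,\cdot)$ if $t\ne\frac{b+c}2$. -/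

import Mathlib

open Set Filter Topology Asymptotics

noncomputable section

/-- The half-width `d` of the tube: a positive continuous function on `[a, b]` with the prescribed
values near `a`, in the middle, and near `b` (and otherwise unrestricted). -/
structure IsTubeWidth (a b c : ℝ) (η : ℝ → ℝ) (δ : ℝ) (d : ℝ → ℝ) : Prop where
  continuousOn : ContinuousOn d (Icc a b)
  pos : ∀ t ∈ Icc a b, 0 < d t
  left : ∀ t ∈ Icc a b, t ≤ a + δ / 2 → d t = |η c - η a| + δ
  middle : ∀ t ∈ Icc a b, a + δ ≤ t → t ≤ b - δ → d t = δ
  right : ∀ t ∈ Icc a b, b - δ / 2 ≤ t → d t = |η b - η c| + δ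

/-- The tube `H(η) = {(t, y) : a ≤ t ≤ b, |y - η t| < d t}`. -/
def tube (a b : ℝ) (η d : ℝ → ℝ) : Set (ℝ × ℝ) :=
  {p | p.1 ∈ Icc a b ∧ |p.2 - η p.1| < d p.1}

/-- `η` solves the reduced equation `k η = f (u, η)` on `[a, b]`. -/
def SolvesReduced (a b k : ℝ) (f : ℝ → ℝ → ℝ) (u η : ℝ → ℝ) : Prop :=
  ∀ t ∈ Icc a b, k * η t = f (u t) (η t)

/-- Regularity of `(t, y) ↦ f (u t) y` on the set `H` (continuous, with a continuous partial
derivative with respect to `y`) together with the bound `|∂f/∂y| ≤ lam`. -/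
structure HasBoundedSlope (H : Set (ℝ × ℝ)) (lam : ℝ) (f : ℝ → ℝ → ℝ) (u : ℝ → ℝ) : Prop where
  continuousOn : ContinuousOn (fun p : ℝ × ℝ => f (u p.1) p.2) H
  differentiableAt : ∀ p ∈ H, DifferentiableAt ℝ (f (u p.1)) p.2
  continuousOn_deriv : ContinuousOn (fun p : ℝ × ℝ => deriv (f (u p.1)) p.2) H
  bound : ∀ p ∈ H, |deriv (f (u p.1)) p.2| ≤ lam

/-- `y` is a `C²` solution on `[a, b]` of `ε y'' + k y = f (u, y)`, `y a = y c = y b`,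
whose graph lies in `H`. -/
structure IsSolutionIn (H : Set (ℝ × ℝ)) (a b c k ε : ℝ) (f : ℝ → ℝ → ℝ) (u y : ℝ → ℝ) :
    Prop where
  contDiffOn : ContDiffOn ℝ 2 y (Icc a b)
  ode : ∀ t ∈ Icc a b,
    ε * iteratedDerivWithin 2 y (Icc a b) t + k * y t = f (u t) (y t)
  bc_left : y a = y c
  bc_right : y c = y b
  mem : ∀ t ∈ Icc a b, (t, y t) ∈ H

/-- The common denominator `D`. -/
def layerD (a b c m ε : ℝ) : ℝ :=
  (Real.exp (√(m / ε) * (b - a)) + Real.exp (√(m / ε) * (c - b)) + Real.exp (√(m / ε) * (a - c)))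
  - (Real.exp (√(m / ε) * (a - b)) + Real.exp (√(m / ε) * (b - c))
    + Real.exp (√(m / ε) * (c - a)))

/-- The normalized left layer function, `ζ_ε / (η c - η a)`. -/
def layerShape (a b c m ε t : ℝ) : ℝ :=
  (Real.exp (√(m / ε) * (b - t)) - Real.exp (√(m / ε) * (t - b))
    + Real.exp (√(m / ε) * (t - c)) - Real.exp (√(m / ε) * (c - t))) / layerD a b c m ε

/-- The normalized right layer function, `ζ̂_ε / |η b - η c|`. -/
def layerShapeHat (a b c m ε t : ℝ) : ℝ :=
  (Real.exp (√(m / ε) * (t - a)) - Real.exp (√(m / ε) * (a - t))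
    + Real.exp (√(m / ε) * (c - t)) - Real.exp (√(m / ε) * (t - c))) / layerD a b c m ε

/-- The boundary layer function `ζ_ε`. -/
def zeta (a b c m : ℝ) (η : ℝ → ℝ) (ε t : ℝ) : ℝ :=
  (η c - η a) * layerShape a b c m ε t

/-- The boundary layer function `ζ̂_ε`. -/
def zetaHat (a b c m : ℝ) (η : ℝ → ℝ) (ε t : ℝ) : ℝ :=
  |η b - η c| * layerShapeHat a b c m ε t

/-- The auxiliary function `ψ_ε`. -/
def psi (a b c m lam : ℝ) (η : ℝ → ℝ) (ε t : ℝ) : ℝ :=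
  lam * |η c - η a| / (layerD a b c m ε * √(m * ε)) * t *
    (Real.exp (√(m / ε) * (b - t)) + Real.exp (√(m / ε) * (t - b))
      - Real.exp (√(m / ε) * (c - t)) - Real.exp (√(m / ε) * (t - c)))

/-- The correction function `v_ε`. The quotients `ζ_ε / (η c - η a)` and `ζ̂_ε / |η b - η c|` are
written as the normalized layer functions, so that they keep their meaning when a denominator
vanishes. -/
def correction (a b c m lam : ℝ) (η : ℝ → ℝ) (ε t : ℝ) : ℝ :=
  -(psi a b c m lam η ε a - psi a b c m lam η ε c) * layerShape a b c m ε t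
    + (psi a b c m lam η ε c - psi a b c m lam η ε b) * layerShapeHat a b c m ε t
    + psi a b c m lam η ε t

/-- The constant `C = (1/m) max {|η'' t| : t ∈ [a, b]}`. -/
def errorConst (a b m : ℝ) (η : ℝ → ℝ) : ℝ :=
  1 / m * sSup ((fun t => |iteratedDerivWithin 2 η (Icc a b) t|) '' Icc a b)

/-- The exponent `χ` of the left layer. -/
def chi (a b c t : ℝ) : ℝ :=
  if t ≤ (b + c) / 2 then a - t else t - b + a - c

/-- `s` and `r` have the same exact order as `ε → 0⁺`: `0 < lim |s / r| < ∞`. -/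
def SameOrder (s r : ℝ → ℝ) : Prop :=
  ∃ L : ℝ, 0 < L ∧ Tendsto (fun ε => |s ε / r ε|) (𝓝[>] 0) (𝓝 L)

end

/-! Everything rests on one maximum principle: if `w a` and `w b` do not exceed `w c`, the maximum
of `w` on `[a, b]` is attained in the open interval, so `w ≤ 0` as soon as `w'' > 0` wherever `w >
0`. Since `λ < -k`, the difference of a sub- and a supersolution has this property. This gives
uniqueness in the tube and all the bounds.

For existence, clamping `y` to the closed subtube of half-width `d - τ` turns `f (u t) y` into a
continuous `F`, globally `λ`-Lipschitz in `y`. The linear problem `ε y'' + k y = g` with three-point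
conditions satisfies `‖y‖ ≤ ‖g‖ / (-k)`, so freezing `y` inside `F` defines a contraction of ratio
`λ / (-k)`, for every `ε > 0`. Barriers made of `η`, the layers and `C ε` trap the fixed point. For
small `ε` they fit into the subtube uniformly in `t`, under a condition on `η` and `d` alone, so `F`
agrees with `f` along the graph and `ε₀` does not depend on `u`.

The layers `Z`, `Ẑ` solve `ε z'' = m z` and have unit jumps, `Z` from `c` to `a` and `Ẑ` from `c` to
`b`, hence repair any defect in the boundary conditions. A barrier containing both `ζ` and terms of
the opposite sign lies on an unknown side of `η`, which costs `2 λ |ζ|`; the correction solves `ε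
v'' = m v - 2 λ |ζ|` precisely to pay for this. Its orders follow from explicit exponentials divided
by the dominant term `e^{s(b-a)}` of `D`. -/

/-- `w` is twice differentiable at every point of `s`, with second derivative `w₂`. -/
def HasSecondDerivOn (w w₂ : ℝ → ℝ) (s : Set ℝ) : Prop :=
  ∃ w₁ : ℝ → ℝ, ∀ t ∈ s, HasDerivAt w (w₁ t) t ∧ HasDerivAt w₁ (w₂ t) t

/-! ### Second derivatives and the maximum principle -/

namespace HasSecondDerivOn

variable {v v₂ w w₂ : ℝ → ℝ} {s s' : Set ℝ}

theorem mono (h : HasSecondDerivOn w w₂ s) (hs : s' ⊆ s) : HasSecondDerivOn w w₂ s' :=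
  h.imp fun _ h t ht => h t (hs ht)

theorem congr_right (h : HasSecondDerivOn w w₂ s) (he : ∀ t ∈ s, w₂ t = v₂ t) :
    HasSecondDerivOn w v₂ s :=
  h.imp fun _ h t ht => he t ht ▸ h t ht

theorem add (hv : HasSecondDerivOn v v₂ s) (hw : HasSecondDerivOn w w₂ s) :
    HasSecondDerivOn (fun t => v t + w t) (fun t => v₂ t + w₂ t) s := by
  obtain ⟨v₁, hv⟩ := hv
  obtain ⟨w₁, hw⟩ := hw
  exact ⟨fun t => v₁ t + w₁ t, fun t ht =>
    ⟨(hv t ht).1.add (hw t ht).1, (hv t ht).2.add (hw t ht).2⟩⟩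

theorem const_mul (r : ℝ) (hw : HasSecondDerivOn w w₂ s) :
    HasSecondDerivOn (fun t => r * w t) (fun t => r * w₂ t) s := by
  obtain ⟨w₁, hw⟩ := hw
  exact ⟨fun t => r * w₁ t, fun t ht => ⟨(hw t ht).1.const_mul r, (hw t ht).2.const_mul r⟩⟩

theorem neg (hw : HasSecondDerivOn w w₂ s) :
    HasSecondDerivOn (fun t => -w t) (fun t => -w₂ t) s := by
  simpa using hw.const_mul (-1)

theorem sub (hv : HasSecondDerivOn v v₂ s) (hw : HasSecondDerivOn w w₂ s) :
    HasSecondDerivOn (fun t => v t - w t) (fun t => v₂ t - w₂ t) s := by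
  simpa [sub_eq_add_neg] using hv.add hw.neg

theorem add_const (r : ℝ) (hw : HasSecondDerivOn w w₂ s) :
    HasSecondDerivOn (fun t => w t + r) w₂ s := by
  obtain ⟨w₁, hw⟩ := hw
  exact ⟨w₁, fun t ht => ⟨(hw t ht).1.add_const r, (hw t ht).2⟩⟩

theorem continuousOn (hw : HasSecondDerivOn w w₂ s) : ContinuousOn w s := by
  obtain ⟨w₁, hw⟩ := hw
  exact fun t ht => (hw t ht).1.continuousAt.continuousWithinAt

theorem continuous (hw : HasSecondDerivOn w w₂ univ) : Continuous w :=
  continuousOn_univ.1 hw.continuousOn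

/-- If `w₂ t > 0`, the second derivative test makes `t` a local minimum too, so `w` is locally
constant and its second derivative at `t` vanishes. -/
theorem nonpos_of_isLocalMax {t : ℝ} (hw : HasSecondDerivOn w w₂ s) (hs : s ∈ 𝓝 t)
    (hmax : IsLocalMax w t) : w₂ t ≤ 0 := by
  obtain ⟨w₁, hw⟩ := hw
  by_contra! hpos
  have ht := mem_of_mem_nhds hs
  have hev : deriv w =ᶠ[𝓝 t] w₁ := by
    filter_upwards [hs] with x hx using (hw x hx).1.deriv
  have h2 : deriv (deriv w) t = w₂ t := by rw [hev.deriv_eq, (hw t ht).2.deriv]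
  have hmin : IsLocalMin w t :=
    isLocalMin_of_deriv_deriv_pos (h2 ▸ hpos) hmax.deriv_eq_zero (hw t ht).1.continuousAt
  have hc : w =ᶠ[𝓝 t] fun _ => w t := by
    filter_upwards [hmax, hmin] with x h h' using le_antisymm h h'
  have h3 : deriv (deriv w) t = 0 := by
    rw [hc.deriv.deriv_eq]; simp
  linarith

/-- The one-sided iterated derivative of a `C²` function on an interval is its second derivative
in the interior. -/
theorem of_contDiffOn {a b : ℝ} (h : ContDiffOn ℝ 2 w (Icc a b)) :
    HasSecondDerivOn w (iteratedDerivWithin 2 w (Icc a b)) (Ioo a b) := by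
  rcases le_or_gt b a with hab | hab
  · exact ⟨0, fun t ht => by simp [Ioo_eq_empty_of_le hab] at ht⟩
  have hu := uniqueDiffOn_Icc hab
  refine ⟨derivWithin w (Icc a b), fun t ht => ?_⟩
  have hn : Icc a b ∈ 𝓝 t := Icc_mem_nhds ht.1 ht.2
  have hd : ContDiffOn ℝ 1 (derivWithin w (Icc a b)) (Icc a b) :=
    h.derivWithin hu (by norm_num)
  refine ⟨?_, ?_⟩
  · exact ((h.differentiableOn (by norm_num) t (Ioo_subset_Icc_self ht)).hasDerivWithinAt).hasDerivAt
      hn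
  · have := ((hd.differentiableOn (by norm_num) t
      (Ioo_subset_Icc_self ht)).hasDerivWithinAt).hasDerivAt hn
    rw [iteratedDerivWithin_eq_iterate]
    exact this

theorem contDiff (h : HasSecondDerivOn w w₂ univ) (hc : Continuous w₂) : ContDiff ℝ 2 w := by
  obtain ⟨w₁, h⟩ := h
  have e1 : deriv w = w₁ := funext fun t => (h t trivial).1.deriv
  have e2 : deriv w₁ = w₂ := funext fun t => (h t trivial).2.deriv
  have h1 : ContDiff ℝ 1 w₁ :=
    contDiff_one_iff_deriv.2 ⟨fun t => (h t trivial).2.differentiableAt, e2 ▸ hc⟩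
  have : ContDiff ℝ (1 + 1) w := contDiff_succ_iff_deriv.2
    ⟨fun t => (h t trivial).1.differentiableAt, by simp, e1 ▸ h1⟩
  simpa [one_add_one_eq_two] using this

theorem iteratedDerivWithin_eq {a b : ℝ} (hab : a < b) (h : HasSecondDerivOn w w₂ univ)
    (hc : Continuous w₂) {t : ℝ} (ht : t ∈ Icc a b) :
    iteratedDerivWithin 2 w (Icc a b) t = w₂ t := by
  rw [iteratedDerivWithin_eq_iteratedDeriv (uniqueDiffOn_Icc hab)
    (h.contDiff hc).contDiffAt ht, iteratedDeriv_succ, iteratedDeriv_one]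
  obtain ⟨w₁, h⟩ := h
  have e1 : deriv w = w₁ := funext fun t => (h t trivial).1.deriv
  rw [e1, (h t trivial).2.deriv]

/-- Maximum principle for three-point problems. -/
theorem nonpos_of_threePoint {a b c : ℝ} (hac : a < c) (hcb : c < b)
    (h : HasSecondDerivOn w w₂ (Ioo a b)) (hc : ContinuousOn w (Icc a b))
    (ha : w a ≤ w c) (hb : w b ≤ w c) (hpos : ∀ t ∈ Ioo a b, 0 < w t → 0 < w₂ t)
    {t : ℝ} (ht : t ∈ Icc a b) : w t ≤ 0 := by
  obtain ⟨x, hx, hmax⟩ := isCompact_Icc.exists_isMaxOn ⟨t, ht⟩ hc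
  -- A maximum at an endpoint is also attained at the interior point `c`, by the boundary
  -- inequalities.
  have key : ∃ x ∈ Ioo a b, IsMaxOn w (Icc a b) x := by
    have hcm : c ∈ Ioo a b := ⟨hac, hcb⟩
    rcases eq_or_lt_of_le hx.1 with h1 | h1
    · exact ⟨c, hcm, fun z hz => (hmax hz).trans (h1 ▸ ha)⟩
    rcases eq_or_lt_of_le hx.2 with h2 | h2
    · exact ⟨c, hcm, fun z hz => (hmax hz).trans (h2 ▸ hb)⟩
    exact ⟨x, ⟨h1, h2⟩, hmax⟩
  obtain ⟨x, hx, hmax⟩ := key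
  by_contra! hlt
  have hxpos : 0 < w x := hlt.trans_le (hmax ht)
  have := h.nonpos_of_isLocalMax (isOpen_Ioo.mem_nhds hx)
    (hmax.isLocalMax (Icc_mem_nhds hx.1 hx.2))
  exact absurd (hpos x hx hxpos) (not_lt.2 this)

end HasSecondDerivOn

/-! ### Layer functions and three-point boundary conditions -/

section Layers

variable {a b c m ε : ℝ}

theorem exp_sub_exp_neg (x : ℝ) : Real.exp x - Real.exp (-x) = 2 * Real.sinh x := by
  rw [Real.sinh_eq]; ring

theorem layerD_eq (a b c m ε : ℝ) :
    layerD a b c m ε = 2 * (Real.sinh (√(m / ε) * (b - a)) - Real.sinh (√(m / ε) * (b - c))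
      - Real.sinh (√(m / ε) * (c - a))) := by
  have h1 := exp_sub_exp_neg (√(m / ε) * (b - a))
  have h2 := exp_sub_exp_neg (√(m / ε) * (b - c))
  have h3 := exp_sub_exp_neg (√(m / ε) * (c - a))
  rw [← mul_neg, neg_sub] at h1 h2 h3
  rw [layerD]
  linarith

theorem layerD_pos (hac : a < c) (hcb : c < b) (hm : 0 < m) (hε : 0 < ε) :
    0 < layerD a b c m ε := by
  have hs : 0 < √(m / ε) := Real.sqrt_pos.2 (div_pos hm hε)
  have hp : 0 < √(m / ε) * (b - c) := mul_pos hs (by linarith)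
  have hq : 0 < √(m / ε) * (c - a) := mul_pos hs (by linarith)
  -- With `p, q > 0`, `sinh (p + q) = sinh p cosh q + cosh p sinh q > sinh p + sinh q`.
  have e : √(m / ε) * (b - a) = √(m / ε) * (b - c) + √(m / ε) * (c - a) := by ring
  rw [layerD_eq, e, Real.sinh_add]
  have h1 := Real.sinh_pos_iff.2 hp
  have h2 := Real.sinh_pos_iff.2 hq
  have h3 := Real.one_lt_cosh.2 hp.ne'
  have h4 := Real.one_lt_cosh.2 hq.ne'
  nlinarith

theorem layerShape_eq (a b c m ε t : ℝ) :
    layerShape a b c m ε t =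
      2 * (Real.sinh (√(m / ε) * (b - t)) - Real.sinh (√(m / ε) * (c - t))) / layerD a b c m ε := by
  have h1 := exp_sub_exp_neg (√(m / ε) * (b - t))
  have h2 := exp_sub_exp_neg (√(m / ε) * (c - t))
  rw [← mul_neg, neg_sub] at h1 h2
  rw [layerShape]
  congr 1
  linarith

theorem layerShapeHat_eq (a b c m ε t : ℝ) :
    layerShapeHat a b c m ε t =
      2 * (Real.sinh (√(m / ε) * (t - a)) - Real.sinh (√(m / ε) * (t - c))) / layerD a b c m ε := by
  have h1 := exp_sub_exp_neg (√(m / ε) * (t - a))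
  have h2 := exp_sub_exp_neg (√(m / ε) * (t - c))
  rw [← mul_neg, neg_sub] at h1 h2
  rw [layerShapeHat]
  congr 1
  linarith

theorem layerShape_pos (hac : a < c) (hcb : c < b) (hm : 0 < m) (hε : 0 < ε) (t : ℝ) :
    0 < layerShape a b c m ε t := by
  have hs : 0 < √(m / ε) := Real.sqrt_pos.2 (div_pos hm hε)
  rw [layerShape_eq]
  have : Real.sinh (√(m / ε) * (c - t)) < Real.sinh (√(m / ε) * (b - t)) :=
    Real.sinh_lt_sinh.2 (mul_lt_mul_of_pos_left (by linarith) hs)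
  exact div_pos (by linarith) (layerD_pos hac hcb hm hε)

theorem layerShapeHat_pos (hac : a < c) (hcb : c < b) (hm : 0 < m) (hε : 0 < ε) (t : ℝ) :
    0 < layerShapeHat a b c m ε t := by
  have hs : 0 < √(m / ε) := Real.sqrt_pos.2 (div_pos hm hε)
  rw [layerShapeHat_eq]
  have : Real.sinh (√(m / ε) * (t - c)) < Real.sinh (√(m / ε) * (t - a)) :=
    Real.sinh_lt_sinh.2 (mul_lt_mul_of_pos_left (by linarith) hs)
  exact div_pos (by linarith) (layerD_pos hac hcb hm hε)

/-- The denominator `D` is exactly the normalization that makes this jump equal to 1. As `Z b = Z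
c`, a multiple of `Z` adjusts the condition at `a` without disturbing the one at `b`; `Ẑ` plays the
mirror role. -/
theorem layerShape_left (hac : a < c) (hcb : c < b) (hm : 0 < m) (hε : 0 < ε) :
    layerShape a b c m ε a = layerShape a b c m ε c + 1 := by
  have hD := (layerD_pos hac hcb hm hε).ne'
  rw [layerShape_eq, layerShape_eq, div_add_one hD, sub_self, mul_zero, Real.sinh_zero]
  congr 1
  rw [layerD_eq]
  ring

theorem layerShape_right : layerShape a b c m ε b = layerShape a b c m ε c := by
  rw [layerShape, layerShape]
  congr 1
  simp

theorem layerShapeHat_left : layerShapeHat a b c m ε a = layerShapeHat a b c m ε c := by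
  rw [layerShapeHat, layerShapeHat]
  congr 1
  simp

theorem layerShapeHat_right (hac : a < c) (hcb : c < b) (hm : 0 < m) (hε : 0 < ε) :
    layerShapeHat a b c m ε b = layerShapeHat a b c m ε c + 1 := by
  have hD := (layerD_pos hac hcb hm hε).ne'
  rw [layerShapeHat_eq, layerShapeHat_eq, div_add_one hD, sub_self, mul_zero, Real.sinh_zero]
  congr 1
  rw [layerD_eq]
  ring

/-- The symmetric companion of the layer function: its derivative is `-√(m / ε) * layerShape`. -/
noncomputable def layerCosh (a b c m ε t : ℝ) : ℝ :=
  (Real.exp (√(m / ε) * (b - t)) + Real.exp (√(m / ε) * (t - b))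
    - Real.exp (√(m / ε) * (c - t)) - Real.exp (√(m / ε) * (t - c))) / layerD a b c m ε

theorem hasDerivAt_exp_mul_sub (r q t : ℝ) :
    HasDerivAt (fun t => Real.exp (r * (t - q))) (r * Real.exp (r * (t - q))) t := by
  have := (((hasDerivAt_id t).sub_const q).const_mul r).exp
  simpa [mul_comm] using this

theorem hasDerivAt_exp_mul_sub' (r q t : ℝ) :
    HasDerivAt (fun t => Real.exp (r * (q - t))) (-(r * Real.exp (r * (q - t)))) t := by
  have := (((hasDerivAt_id t).const_sub q).const_mul r).exp
  simpa [mul_comm] using this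

theorem hasDerivAt_layerCosh (a b c m ε t : ℝ) :
    HasDerivAt (layerCosh a b c m ε) (-√(m / ε) * layerShape a b c m ε t) t := by
  have h := ((((hasDerivAt_exp_mul_sub' √(m / ε) b t).add
    (hasDerivAt_exp_mul_sub √(m / ε) b t)).sub (hasDerivAt_exp_mul_sub' √(m / ε) c t)).sub
    (hasDerivAt_exp_mul_sub √(m / ε) c t)).div_const (layerD a b c m ε)
  refine h.congr_deriv ?_
  rw [layerShape]
  ring

theorem hasDerivAt_layerShape (a b c m ε t : ℝ) :
    HasDerivAt (layerShape a b c m ε) (-√(m / ε) * layerCosh a b c m ε t) t := by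
  have h := ((((hasDerivAt_exp_mul_sub' √(m / ε) b t).sub
    (hasDerivAt_exp_mul_sub √(m / ε) b t)).add (hasDerivAt_exp_mul_sub √(m / ε) c t)).sub
    (hasDerivAt_exp_mul_sub' √(m / ε) c t)).div_const (layerD a b c m ε)
  refine h.congr_deriv ?_
  rw [layerCosh]
  ring

theorem hasSecondDerivOn_layerShape (hm : 0 < m) (hε : 0 < ε) (s : Set ℝ) :
    HasSecondDerivOn (layerShape a b c m ε) (fun t => m / ε * layerShape a b c m ε t) s := by
  refine ⟨_, fun t _ => ⟨hasDerivAt_layerShape a b c m ε t,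
    ((hasDerivAt_layerCosh a b c m ε t).const_mul _).congr_deriv ?_⟩⟩
  have := Real.mul_self_sqrt (div_pos hm hε).le
  linear_combination layerShape a b c m ε t * this

theorem hasSecondDerivOn_layerShapeHat (hm : 0 < m) (hε : 0 < ε) (s : Set ℝ) :
    HasSecondDerivOn (layerShapeHat a b c m ε) (fun t => m / ε * layerShapeHat a b c m ε t) s := by
  refine ⟨fun t => √(m / ε) * ((Real.exp (√(m / ε) * (t - a)) +
    Real.exp (√(m / ε) * (a - t)) - Real.exp (√(m / ε) * (c - t)) - Real.exp (√(m / ε) * (t - c)))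
    / layerD a b c m ε), fun t _ => ⟨?_, ?_⟩⟩
  · have h := ((((hasDerivAt_exp_mul_sub √(m / ε) a t).sub
      (hasDerivAt_exp_mul_sub' √(m / ε) a t)).add (hasDerivAt_exp_mul_sub' √(m / ε) c t)).sub
      (hasDerivAt_exp_mul_sub √(m / ε) c t)).div_const (layerD a b c m ε)
    exact h.congr_deriv (by ring)
  · have h := (((((hasDerivAt_exp_mul_sub √(m / ε) a t).add
      (hasDerivAt_exp_mul_sub' √(m / ε) a t)).sub (hasDerivAt_exp_mul_sub' √(m / ε) c t)).sub
      (hasDerivAt_exp_mul_sub √(m / ε) c t)).div_const (layerD a b c m ε)).const_mul √(m / ε)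
    refine h.congr_deriv ?_
    have := Real.mul_self_sqrt (div_pos hm hε).le
    simp only [layerShapeHat]
    rw [← mul_div_assoc]
    linear_combination ((Real.exp (√(m / ε) * (t - a)) - Real.exp (√(m / ε) * (a - t)) +
      Real.exp (√(m / ε) * (c - t)) - Real.exp (√(m / ε) * (t - c))) / layerD a b c m ε) * this

/-- Adding multiples of the layer functions to `w` to meet the three-point boundary conditions. -/
noncomputable def threePointAdjust (a b c m ε : ℝ) (w : ℝ → ℝ) (t : ℝ) : ℝ :=
  -(w a - w c) * layerShape a b c m ε t + (w c - w b) * layerShapeHat a b c m ε t + w t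

theorem threePointAdjust_left (hac : a < c) (hcb : c < b) (hm : 0 < m) (hε : 0 < ε) (w : ℝ → ℝ) :
    threePointAdjust a b c m ε w a = threePointAdjust a b c m ε w c := by
  rw [threePointAdjust, threePointAdjust, layerShape_left hac hcb hm hε, layerShapeHat_left]
  ring

theorem threePointAdjust_right (hac : a < c) (hcb : c < b) (hm : 0 < m) (hε : 0 < ε)
    (w : ℝ → ℝ) : threePointAdjust a b c m ε w b = threePointAdjust a b c m ε w c := by
  rw [threePointAdjust, threePointAdjust, layerShapeHat_right hac hcb hm hε, layerShape_right]
  ring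

/-- The added layers solve the homogeneous equation, so the source `g` is unchanged. -/
theorem HasSecondDerivOn.threePointAdjust (hm : 0 < m) (hε : 0 < ε) {s : Set ℝ} {w g : ℝ → ℝ}
    (h : HasSecondDerivOn w (fun t => m / ε * w t + g t) s) :
    HasSecondDerivOn (threePointAdjust a b c m ε w)
      (fun t => m / ε * threePointAdjust a b c m ε w t + g t) s := by
  refine ((((hasSecondDerivOn_layerShape hm hε s).const_mul (-(w a - w c))).add
    ((hasSecondDerivOn_layerShapeHat hm hε s).const_mul (w c - w b))).add h).congr_right ?_
  intro t _
  simp only [_root_.threePointAdjust]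
  ring

end Layers

/-! ### The correction function and its sign -/

section Correction

variable {a b c m ε lam : ℝ} {η : ℝ → ℝ}

theorem psi_eq (a b c m lam : ℝ) (η : ℝ → ℝ) (ε t : ℝ) :
    psi a b c m lam η ε t =
      lam * |η c - η a| / √(m * ε) * (t * layerCosh a b c m ε t) := by
  rw [psi, layerCosh, div_mul_eq_div_div_swap]
  ring

theorem sqrt_mul_eq_mul_sqrt_div (hε : 0 < ε) : √(m * ε) = ε * √(m / ε) := by
  have : m * ε = ε ^ 2 * (m / ε) := by field_simp
  rw [this, Real.sqrt_mul (by positivity), Real.sqrt_sq hε.le]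

/-- The source is itself a homogeneous solution, so the particular solution is resonant: `t` times
`layerCosh`. The product rule leaves twice the derivative of `layerCosh`, a multiple of
`layerShape`. -/
theorem hasSecondDerivOn_psi (hm : 0 < m) (hε : 0 < ε) (s : Set ℝ) :
    HasSecondDerivOn (psi a b c m lam η ε) (fun t => m / ε * psi a b c m lam η ε t +
      -(2 * lam * |η c - η a| / ε * layerShape a b c m ε t)) s := by
  have e : psi a b c m lam η ε = fun t =>
      lam * |η c - η a| / √(m * ε) * (t * layerCosh a b c m ε t) := funext (psi_eq a b c m lam η ε)
  have hs : 0 < √(m / ε) := Real.sqrt_pos.2 (div_pos hm hε)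
  rw [e]
  refine HasSecondDerivOn.congr_right (HasSecondDerivOn.const_mul
    (w₂ := fun t => m / ε * (t * layerCosh a b c m ε t) - 2 * √(m / ε) * layerShape a b c m ε t)
    _ ?_) ?_
  · refine ⟨fun t => layerCosh a b c m ε t + t * (-√(m / ε) * layerShape a b c m ε t),
      fun t _ => ⟨?_, ?_⟩⟩
    · exact ((hasDerivAt_id t).mul (hasDerivAt_layerCosh a b c m ε t)).congr_deriv (by simp)
    · refine ((hasDerivAt_layerCosh a b c m ε t).add ((hasDerivAt_id t).mul
        ((hasDerivAt_layerShape a b c m ε t).const_mul _))).congr_deriv ?_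
      have := Real.mul_self_sqrt (div_pos hm hε).le
      simp only [id]
      linear_combination t * layerCosh a b c m ε t * this
  · intro t _
    simp only
    rw [sqrt_mul_eq_mul_sqrt_div hε]
    field_simp
    ring

theorem hasSecondDerivOn_correction (hm : 0 < m) (hε : 0 < ε) (s : Set ℝ) :
    HasSecondDerivOn (correction a b c m lam η ε) (fun t => m / ε * correction a b c m lam η ε t +
      -(2 * lam * |η c - η a| / ε * layerShape a b c m ε t)) s :=
  -- By definition `correction` is `threePointAdjust` applied to `psi`.
  (hasSecondDerivOn_psi hm hε s).threePointAdjust hm hε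

/-- The source of `v` is nonpositive, so `-v` has positive second derivative wherever `-v > 0`. -/
theorem correction_nonneg (hac : a < c) (hcb : c < b) (hm : 0 < m) (hε : 0 < ε) (hlam : 0 ≤ lam)
    {t : ℝ} (ht : t ∈ Icc a b) : 0 ≤ correction a b c m lam η ε t := by
  have h := (hasSecondDerivOn_correction (a := a) (b := b) (c := c) (lam := lam) (η := η) hm hε
    univ).neg
  have := (h.mono (subset_univ (Ioo a b))).nonpos_of_threePoint hac hcb h.continuous.continuousOn
    (neg_le_neg (threePointAdjust_left hac hcb hm hε _).ge)
    (neg_le_neg (threePointAdjust_right hac hcb hm hε _).ge) ?_ ht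
  · linarith
  · intro t _ hneg
    have h1 := layerShape_pos hac hcb hm hε t
    have h2 : 0 ≤ 2 * lam * |η c - η a| / ε * layerShape a b c m ε t := by positivity
    have h3 := mul_pos (div_pos hm hε) hneg
    linarith

theorem correction_pos (hac : a < c) (hcb : c < b) (hm : 0 < m) (hε : 0 < ε) (hlam : 0 < lam)
    (hne : η c ≠ η a) {t : ℝ} (ht : t ∈ Icc a b) : 0 < correction a b c m lam η ε t := by
  -- An interior zero would be a minimum of `v`, yet there `v''` equals the strictly negative
  -- source. A zero at `a` or `b` is also a zero at `c`.
  have key : ∀ x ∈ Ioo a b, correction a b c m lam η ε x ≠ 0 := by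
    intro x hx h0
    have h := (hasSecondDerivOn_correction (a := a) (b := b) (c := c) (lam := lam) (η := η) hm hε
      (Ioo a b)).neg
    have hmax : IsLocalMax (fun t => -correction a b c m lam η ε t) x := by
      filter_upwards [Icc_mem_nhds hx.1 hx.2] with z hz
      have := correction_nonneg (lam := lam) (η := η) hac hcb hm hε hlam.le hz
      linarith
    have h1 := h.nonpos_of_isLocalMax (isOpen_Ioo.mem_nhds hx) hmax
    have h2 := layerShape_pos hac hcb hm hε x
    have h3 : 0 < |η c - η a| := abs_pos.2 (sub_ne_zero.2 hne)
    have h4 : 0 < 2 * lam * |η c - η a| / ε * layerShape a b c m ε x := by positivity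
    rw [h0] at h1
    linarith
  refine lt_of_le_of_ne (correction_nonneg hac hcb hm hε hlam.le ht) fun h0 => ?_
  rcases eq_or_lt_of_le ht.1 with h1 | h1
  · exact key c ⟨hac, hcb⟩ ((threePointAdjust_left hac hcb hm hε _).symm.trans (h1 ▸ h0.symm))
  rcases eq_or_lt_of_le ht.2 with h2 | h2
  · exact key c ⟨hac, hcb⟩ ((threePointAdjust_right hac hcb hm hε _).symm.trans (h2 ▸ h0.symm))
  exact key t ⟨h1, h2⟩ h0.symm

end Correction

/-! ### Existence for a Lipschitz right-hand side -/

section Existence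

/-- Variation of parameters with `sinh (κ t)` and `cosh (κ t)`, where `κ² = r`. -/
theorem exists_hasSecondDerivOn_linear {r : ℝ} (hr : 0 < r) {g : ℝ → ℝ} (hg : Continuous g) :
    ∃ y : ℝ → ℝ, HasSecondDerivOn y (fun t => r * y t + g t) univ := by
  obtain ⟨κ, hκ, rfl⟩ : ∃ κ : ℝ, 0 < κ ∧ κ * κ = r :=
    ⟨√r, Real.sqrt_pos.2 hr, Real.mul_self_sqrt hr.le⟩
  have hs (t : ℝ) : HasDerivAt (fun t => Real.sinh (κ * t)) (κ * Real.cosh (κ * t)) t := by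
    simpa [mul_comm] using ((hasDerivAt_id t).const_mul κ).sinh
  have hc (t : ℝ) : HasDerivAt (fun t => Real.cosh (κ * t)) (κ * Real.sinh (κ * t)) t := by
    simpa [mul_comm] using ((hasDerivAt_id t).const_mul κ).cosh
  have hcg : Continuous fun t => Real.cosh (κ * t) * g t :=
    (continuous_iff_continuousAt.2 fun t => (hc t).continuousAt).mul hg
  have hsg : Continuous fun t => Real.sinh (κ * t) * g t :=
    (continuous_iff_continuousAt.2 fun t => (hs t).continuousAt).mul hg
  obtain ⟨A, hA⟩ : ∃ A : ℝ → ℝ, ∀ t, HasDerivAt A (Real.cosh (κ * t) * g t) t :=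
    ⟨_, fun t => intervalIntegral.integral_hasDerivAt_right (hcg.intervalIntegrable 0 t)
      (hcg.stronglyMeasurableAtFilter _ _) hcg.continuousAt⟩
  obtain ⟨B, hB⟩ : ∃ B : ℝ → ℝ, ∀ t, HasDerivAt B (Real.sinh (κ * t) * g t) t :=
    ⟨_, fun t => intervalIntegral.integral_hasDerivAt_right (hsg.intervalIntegrable 0 t)
      (hsg.stronglyMeasurableAtFilter _ _) hsg.continuousAt⟩
  refine ⟨fun t => (Real.sinh (κ * t) * A t - Real.cosh (κ * t) * B t) / κ,
    fun t => Real.cosh (κ * t) * A t - Real.sinh (κ * t) * B t, fun t _ => ⟨?_, ?_⟩⟩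
  · refine ((((hs t).mul (hA t)).sub ((hc t).mul (hB t))).div_const κ).congr_deriv ?_
    field_simp
    ring
  · refine (((hc t).mul (hA t)).sub ((hs t).mul (hB t))).congr_deriv ?_
    have := Real.cosh_sq_sub_sinh_sq (κ * t)
    field_simp
    linear_combination g t * this

variable {a b c p ε : ℝ}

theorem exists_threePoint_linear (hac : a < c) (hcb : c < b) (hp : 0 < p) (hε : 0 < ε)
    {g : ℝ → ℝ} (hg : Continuous g) :
    ∃ y : ℝ → ℝ, HasSecondDerivOn y (fun t => p / ε * y t + g t) univ ∧ y a = y c ∧ y b = y c := by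
  obtain ⟨w, hw⟩ := exists_hasSecondDerivOn_linear (div_pos hp hε) hg
  exact ⟨_, hw.threePointAdjust hp hε, threePointAdjust_left hac hcb hp hε w,
    threePointAdjust_right hac hcb hp hε w⟩

/-- The constant `M / p` is a supersolution satisfying the boundary conditions. -/
theorem threePoint_linear_le (hac : a < c) (hcb : c < b) (hp : 0 < p) (hε : 0 < ε)
    {g w : ℝ → ℝ} {M : ℝ} (hw : HasSecondDerivOn w (fun t => p / ε * w t + g t) univ)
    (ha : w a = w c) (hb : w b = w c) (hg : ∀ t ∈ Icc a b, -M ≤ ε * g t)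
    {t : ℝ} (ht : t ∈ Icc a b) : w t ≤ M / p := by
  have h := hw.add_const (-(M / p))
  have := (h.mono (subset_univ (Ioo a b))).nonpos_of_threePoint hac hcb h.continuous.continuousOn
    (by simp [ha]) (by simp [hb]) ?_ ht
  · linarith
  · intro x hx hpos
    have h1 := hg x (Ioo_subset_Icc_self hx)
    have h2 : M < p * w x := by
      have : M / p < w x := by linarith
      rwa [div_lt_iff₀' hp] at this
    have h3 : p / ε * w x + g x = (p * w x + ε * g x) / ε := by field_simp
    rw [h3]
    exact div_pos (by linarith) hε

theorem abs_threePoint_linear_le (hac : a < c) (hcb : c < b) (hp : 0 < p) (hε : 0 < ε)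
    {g w : ℝ → ℝ} {M : ℝ} (hw : HasSecondDerivOn w (fun t => p / ε * w t + g t) univ)
    (ha : w a = w c) (hb : w b = w c) (hg : ∀ t ∈ Icc a b, |ε * g t| ≤ M)
    {t : ℝ} (ht : t ∈ Icc a b) : |w t| ≤ M / p := by
  refine abs_le'.2 ⟨threePoint_linear_le hac hcb hp hε hw ha hb
    (fun t ht => (abs_le.1 (hg t ht)).1) ht, ?_⟩
  refine threePoint_linear_le (w := fun t => -w t) (g := fun t => -g t) hac hcb hp hε
    (hw.neg.congr_right fun t _ => by ring) (by simp [ha]) (by simp [hb]) (fun t ht => ?_) ht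
  have := (abs_le.1 (hg t ht)).2
  linarith

/-- The three-point problem is solvable when the right-hand side is Lipschitz with a constant
below `-k`. -/
theorem exists_threePoint_of_lipschitz {k lam : ℝ} (hac : a < c) (hcb : c < b) (hlam : 0 ≤ lam)
    (hlamk : lam < -k) (hε : 0 < ε) {F : ℝ → ℝ → ℝ} (hF : Continuous fun q : ℝ × ℝ => F q.1 q.2)
    (hL : ∀ t ∈ Icc a b, ∀ x y, |F t x - F t y| ≤ lam * |x - y|) :
    ∃ y y₂ : ℝ → ℝ, HasSecondDerivOn y y₂ univ ∧ Continuous y₂ ∧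
      (∀ t ∈ Icc a b, ε * y₂ t + k * y t = F t (y t)) ∧ y a = y c ∧ y b = y c := by
  have hab : a ≤ b := (hac.trans hcb).le
  have hp : 0 < -k := hlam.trans_lt hlamk
  -- Freezing `Y` in the nonlinearity leaves a linear problem with `p = -k`; `projIcc` makes the
  -- source continuous on the whole line.
  let rhs (Y : C(Icc a b, ℝ)) (t : ℝ) : ℝ := F t (Y (projIcc a b hab t)) / ε
  have hrhs (Y : C(Icc a b, ℝ)) : Continuous (rhs Y) :=
    (hF.comp (continuous_id.prodMk (Y.continuous.comp continuous_projIcc))).div_const ε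
  choose S hS hSa hSb using fun Y => exists_threePoint_linear hac hcb hp hε (hrhs Y)
  let T (Y : C(Icc a b, ℝ)) : C(Icc a b, ℝ) :=
    ⟨fun t => S Y t, (hS Y).continuous.comp continuous_subtype_val⟩
  obtain ⟨K, hK⟩ : ∃ K : NNReal, (K : ℝ) = lam / -k := ⟨⟨_, div_nonneg hlam hp.le⟩, rfl⟩
  have hT : ContractingWith K T := by
    refine ⟨?_, LipschitzWith.of_dist_le_mul fun Y₁ Y₂ => ?_⟩
    · rw [← NNReal.coe_lt_coe, hK]
      exact (div_lt_one hp).2 hlamk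
    · refine (ContinuousMap.dist_le (by positivity)).2 fun t => ?_
      -- The difference of two images solves the linear problem with source at most `lam * dist Y₁
      -- Y₂`, whence the ratio `lam / -k`.
      have h := abs_threePoint_linear_le hac hcb hp hε (M := lam * dist Y₁ Y₂)
        (((hS Y₁).sub (hS Y₂)).congr_right (v₂ := fun t => -k / ε * (S Y₁ t - S Y₂ t) +
          (rhs Y₁ t - rhs Y₂ t)) fun t _ => by ring) (by simp [hSa]) (by simp [hSb]) ?_ t.2
      · rw [Real.dist_eq]
        refine h.trans (le_of_eq ?_)
        rw [hK]
        ring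
      · intro x hx
        have e : ε * (rhs Y₁ x - rhs Y₂ x) =
            F x (Y₁ (projIcc a b hab x)) - F x (Y₂ (projIcc a b hab x)) := by
          simp only [rhs]
          field_simp
        rw [e]
        refine (hL x hx _ _).trans (mul_le_mul_of_nonneg_left ?_ hlam)
        rw [← Real.dist_eq]
        exact ContinuousMap.dist_apply_le_dist _
  obtain ⟨Y, hY, -⟩ := hT.exists_fixedPoint 0 (edist_ne_top _ _)
  refine ⟨S Y, _, hS Y, ((hS Y).continuous.const_mul _).add (hrhs Y), fun t ht => ?_, hSa Y, hSb Y⟩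
  have e : Y (projIcc a b hab t) = S Y t := by
    rw [projIcc_of_mem hab ht]
    exact (DFunLike.congr_fun hY ⟨t, ht⟩).symm
  simp only [rhs, e]
  field_simp
  ring

end Existence

/-! ### Comparison of sub- and supersolutions -/

section Comparison

variable {a b c k lam ε : ℝ} {F : ℝ → ℝ → ℝ} {y y₂ β β₂ : ℝ → ℝ}

/-- A subsolution lies below every supersolution with compatible boundary values. -/
theorem threePoint_comparison (hac : a < c) (hcb : c < b) (hε : 0 < ε) (hlamk : lam < -k)
    (hL : ∀ t ∈ Ioo a b, |F t (y t) - F t (β t)| ≤ lam * |y t - β t|)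
    (hy : HasSecondDerivOn y y₂ (Ioo a b)) (hyc : ContinuousOn y (Icc a b))
    (hβ : HasSecondDerivOn β β₂ (Ioo a b)) (hβc : ContinuousOn β (Icc a b))
    (hyF : ∀ t ∈ Ioo a b, F t (y t) ≤ ε * y₂ t + k * y t)
    (hβF : ∀ t ∈ Ioo a b, ε * β₂ t + k * β t ≤ F t (β t))
    (ha : y a - β a ≤ y c - β c) (hb : y b - β b ≤ y c - β c) {t : ℝ} (ht : t ∈ Icc a b) :
    y t ≤ β t := by
  refine sub_nonpos.1 ((hy.sub hβ).nonpos_of_threePoint hac hcb (hyc.sub hβc) ha hb ?_ ht)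
  intro x hx hpos
  have h1 := hL x hx
  rw [abs_of_pos hpos] at h1
  have h2 := (abs_le.1 h1).1
  have h3 := hyF x hx
  have h4 := hβF x hx
  -- Subtracting the two differential inequalities gives `ε (y - β)'' ≥ (-k - lam) (y - β)` where `y
  -- > β`.
  have h5 : 0 < (-k - lam) * (y x - β x) := mul_pos (by linarith) hpos
  refine pos_of_mul_pos_right (a := ε) ?_ hε.le
  linarith

end Comparison

/-! ### Barriers around the reduced solution -/

section Estimates

variable {a b c k lam ε m C : ℝ} {F : ℝ → ℝ → ℝ} {η η₂ y y₂ : ℝ → ℝ}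

/-- The layers decay at rate `m = -k - lam`, which just balances the worst slope of `F`. The middle
bound, free of `v`, serves to keep the solution in the tube; the other two are the estimates of the
theorem. -/
theorem solution_bounds_of_nonneg (hac : a < c) (hcb : c < b) (hε : 0 < ε) (hlam : 0 ≤ lam)
    (hmk : m = -k - lam) (hm : 0 < m)
    (hL : ∀ t ∈ Icc a b, ∀ x y, |F t x - F t y| ≤ lam * |x - y|)
    (hη : HasSecondDerivOn η η₂ (Ioo a b)) (hηc : ContinuousOn η (Icc a b))
    (hC : ∀ t ∈ Ioo a b, |η₂ t| ≤ m * C) (hηF : ∀ t ∈ Icc a b, F t (η t) = k * η t)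
    (hy : HasSecondDerivOn y y₂ (Ioo a b)) (hyc : ContinuousOn y (Icc a b))
    (hyF : ∀ t ∈ Icc a b, ε * y₂ t + k * y t = F t (y t)) (hya : y a = y c) (hyb : y b = y c)
    (hΔ : 0 ≤ η c - η a) {t : ℝ} (ht : t ∈ Icc a b) :
    y t ≤ η t + zeta a b c m η ε t + zetaHat a b c m η ε t + C * ε ∧
    η t - zetaHat a b c m η ε t - C * ε ≤ y t ∧
    η t + zeta a b c m η ε t - correction a b c m lam η ε t - zetaHat a b c m η ε t - C * ε
      ≤ y t := by
  have hlamk : lam < -k := by linarith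
  have hL' {p q : ℝ → ℝ} (t : ℝ) (ht : t ∈ Ioo a b) :
      |F t (p t) - F t (q t)| ≤ lam * |p t - q t| := hL t (Ioo_subset_Icc_self ht) _ _
  have hZ := (hasSecondDerivOn_layerShape (a := a) (b := b) (c := c) hm hε univ).const_mul
    (η c - η a)
  have hZhat := (hasSecondDerivOn_layerShapeHat (a := a) (b := b) (c := c) hm hε univ).const_mul
    |η b - η c|
  have hv := hasSecondDerivOn_correction (a := a) (b := b) (c := c) (lam := lam) (η := η) hm hε univ
  have hs := subset_univ (Ioo a b)
  have hC0 : 0 ≤ C := nonneg_of_mul_nonneg_right ((abs_nonneg _).trans (hC c ⟨hac, hcb⟩)) hm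
  have hCε : 0 ≤ C * ε := mul_nonneg hC0 hε.le
  have hζ0 (x : ℝ) : 0 ≤ zeta a b c m η ε x :=
    mul_nonneg hΔ (layerShape_pos hac hcb hm hε x).le
  have hζh0 (x : ℝ) : 0 ≤ zetaHat a b c m η ε x :=
    mul_nonneg (abs_nonneg _) (layerShapeHat_pos hac hcb hm hε x).le
  have eζa : zeta a b c m η ε a = zeta a b c m η ε c + (η c - η a) := by
    rw [zeta, zeta, layerShape_left hac hcb hm hε]; ring
  have eζb : zeta a b c m η ε b = zeta a b c m η ε c := by
    rw [zeta, zeta, layerShape_right]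
  have eha : zetaHat a b c m η ε a = zetaHat a b c m η ε c := by
    rw [zetaHat, zetaHat, layerShapeHat_left]
  have ehb : zetaHat a b c m η ε b = zetaHat a b c m η ε c + |η b - η c| := by
    rw [zetaHat, zetaHat, layerShapeHat_right hac hcb hm hε]; ring
  have eva : correction a b c m lam η ε a = correction a b c m lam η ε c :=
    threePointAdjust_left hac hcb hm hε _
  have evb : correction a b c m lam η ε b = correction a b c m lam η ε c :=
    threePointAdjust_right hac hcb hm hε _
  have hηb := abs_le.1 (le_refl |η b - η c|)
  have hη₂ (x : ℝ) (hx : x ∈ Ioo a b) : |ε * η₂ x| ≤ m * (C * ε) := by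
    rw [abs_mul, abs_of_pos hε]
    have := mul_le_mul_of_nonneg_left (hC x hx) hε.le
    linarith
  refine ⟨?_, ?_, ?_⟩
  -- Upper barrier `η + ζ + ζ̂ + C ε`: it lies above `η`, so the Lipschitz bound loses exactly `lam`
  -- times its distance to `η`.
  · refine threePoint_comparison hac hcb hε hlamk hL' hy hyc
      (((hη.add (hZ.mono hs)).add (hZhat.mono hs)).add_const (C * ε))
      (((hηc.add hZ.continuous.continuousOn).add hZhat.continuous.continuousOn).add
        continuousOn_const) (fun x hx => (hyF x (Ioo_subset_Icc_self hx)).ge) ?_ ?_ ?_ ht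
    · intro x hx
      change ε * (η₂ x + (η c - η a) * (m / ε * layerShape a b c m ε x)
        + |η b - η c| * (m / ε * layerShapeHat a b c m ε x))
        + k * (η x + zeta a b c m η ε x + zetaHat a b c m η ε x + C * ε)
        ≤ F x (η x + zeta a b c m η ε x + zetaHat a b c m η ε x + C * ε)
      have e : ε * (η₂ x + (η c - η a) * (m / ε * layerShape a b c m ε x)
          + |η b - η c| * (m / ε * layerShapeHat a b c m ε x))
          = ε * η₂ x + m * zeta a b c m η ε x + m * zetaHat a b c m η ε x := by
        rw [zeta, zetaHat]; field_simp
      rw [e]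
      have h1 := hL x (Ioo_subset_Icc_self hx)
        (η x + zeta a b c m η ε x + zetaHat a b c m η ε x + C * ε) (η x)
      rw [hηF x (Ioo_subset_Icc_self hx), abs_of_nonneg (a := _ - η x)
        (by linarith [hζ0 x, hζh0 x])] at h1
      have h2 := (abs_le.1 h1).1
      have h3 := (abs_le.1 (hη₂ x hx)).2
      subst hmk
      linarith
    · change y a - (η a + zeta a b c m η ε a + zetaHat a b c m η ε a + C * ε) ≤
        y c - (η c + zeta a b c m η ε c + zetaHat a b c m η ε c + C * ε)
      linarith
    · change y b - (η b + zeta a b c m η ε b + zetaHat a b c m η ε b + C * ε) ≤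
        y c - (η c + zeta a b c m η ε c + zetaHat a b c m η ε c + C * ε)
      linarith
  -- Lower barrier without `ζ`: since `η a ≤ η c`, the condition at `a` already has the right sign.
  · refine threePoint_comparison hac hcb hε hlamk hL' ((hη.sub (hZhat.mono hs)).add_const (-(C * ε)))
      ((hηc.sub hZhat.continuous.continuousOn).add continuousOn_const) hy hyc ?_
      (fun x hx => (hyF x (Ioo_subset_Icc_self hx)).le) ?_ ?_ ht
    · intro x hx
      change F x (η x - zetaHat a b c m η ε x + -(C * ε)) ≤
        ε * (η₂ x - |η b - η c| * (m / ε * layerShapeHat a b c m ε x))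
        + k * (η x - zetaHat a b c m η ε x + -(C * ε))
      have e : ε * (η₂ x - |η b - η c| * (m / ε * layerShapeHat a b c m ε x))
          = ε * η₂ x - m * zetaHat a b c m η ε x := by
        rw [zetaHat]; field_simp
      rw [e]
      have h1 := hL x (Ioo_subset_Icc_self hx) (η x - zetaHat a b c m η ε x + -(C * ε)) (η x)
      rw [hηF x (Ioo_subset_Icc_self hx), abs_of_nonpos (a := _ - η x)
        (by linarith [hζh0 x])] at h1
      have h2 := (abs_le.1 h1).2
      have h3 := (abs_le.1 (hη₂ x hx)).1
      subst hmk
      linarith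
    · change η a - zetaHat a b c m η ε a + -(C * ε) - y a ≤
        η c - zetaHat a b c m η ε c + -(C * ε) - y c
      linarith
    · change η b - zetaHat a b c m η ε b + -(C * ε) - y b ≤
        η c - zetaHat a b c m η ε c + -(C * ε) - y c
      linarith
  -- Lower barrier `η + w` with `w = ζ - v - ζ̂ - C ε` of unknown sign. The source `2 lam ζ` coming
  -- from `-v` turns `-lam ζ` into `+lam ζ`, leaving at least `lam (ζ + v + ζ̂ + C ε) ≥ lam |w|`.
  · refine threePoint_comparison hac hcb hε hlamk hL'
      ((((hη.add (hZ.mono hs)).sub (hv.mono hs)).sub (hZhat.mono hs)).add_const (-(C * ε)))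
      ((((hηc.add hZ.continuous.continuousOn).sub hv.continuous.continuousOn).sub
        hZhat.continuous.continuousOn).add continuousOn_const) hy hyc ?_
      (fun x hx => (hyF x (Ioo_subset_Icc_self hx)).le) ?_ ?_ ht
    · intro x hx
      set v := correction a b c m lam η ε x with hvx
      have hv0 : 0 ≤ v := correction_nonneg hac hcb hm hε hlam (Ioo_subset_Icc_self hx)
      change F x (η x + zeta a b c m η ε x - v - zetaHat a b c m η ε x + -(C * ε)) ≤
        ε * (η₂ x + (η c - η a) * (m / ε * layerShape a b c m ε x)
        - (m / ε * v + -(2 * lam * |η c - η a| / ε * layerShape a b c m ε x))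
        - |η b - η c| * (m / ε * layerShapeHat a b c m ε x))
        + k * (η x + zeta a b c m η ε x - v - zetaHat a b c m η ε x + -(C * ε))
      have e : ε * (η₂ x + (η c - η a) * (m / ε * layerShape a b c m ε x)
          - (m / ε * v + -(2 * lam * |η c - η a| / ε * layerShape a b c m ε x))
          - |η b - η c| * (m / ε * layerShapeHat a b c m ε x))
          = ε * η₂ x + m * zeta a b c m η ε x - m * v + 2 * lam * zeta a b c m η ε x
            - m * zetaHat a b c m η ε x := by
        rw [zeta, zetaHat, abs_of_nonneg hΔ]; field_simp; ring
      rw [e]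
      have h1 := hL x (Ioo_subset_Icc_self hx)
        (η x + zeta a b c m η ε x - v - zetaHat a b c m η ε x + -(C * ε)) (η x)
      rw [hηF x (Ioo_subset_Icc_self hx)] at h1
      have h3 := (abs_le.1 (hη₂ x hx)).1
      have h4 := mul_nonneg hlam (hζ0 x)
      have h5 := mul_nonneg hlam (hζh0 x)
      have h6 := mul_nonneg hlam hv0
      have h7 := mul_nonneg hlam hCε
      have h2 := (abs_le.1 h1).2
      subst hmk
      rcases le_total 0 (η x + zeta a b c (-k - lam) η ε x - v - zetaHat a b c (-k - lam) η ε x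
        + -(C * ε) - η x) with h | h
      · rw [abs_of_nonneg h] at h2
        linarith
      · rw [abs_of_nonpos h] at h2
        linarith
    · change η a + zeta a b c m η ε a - correction a b c m lam η ε a - zetaHat a b c m η ε a
        + -(C * ε) - y a ≤ η c + zeta a b c m η ε c - correction a b c m lam η ε c
        - zetaHat a b c m η ε c + -(C * ε) - y c
      linarith
    · change η b + zeta a b c m η ε b - correction a b c m lam η ε b - zetaHat a b c m η ε b
        + -(C * ε) - y b ≤ η c + zeta a b c m η ε c - correction a b c m lam η ε c
        - zetaHat a b c m η ε c + -(C * ε) - y c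
      linarith

theorem zeta_neg (a b c m : ℝ) (η : ℝ → ℝ) (ε t : ℝ) :
    zeta a b c m (fun t => -η t) ε t = -zeta a b c m η ε t := by
  simp only [zeta]; ring

theorem zetaHat_neg (a b c m : ℝ) (η : ℝ → ℝ) (ε t : ℝ) :
    zetaHat a b c m (fun t => -η t) ε t = zetaHat a b c m η ε t := by
  rw [zetaHat, zetaHat, ← abs_neg (η b - η c)]; congr 2; ring

theorem correction_neg (a b c m lam : ℝ) (η : ℝ → ℝ) (ε t : ℝ) :
    correction a b c m lam (fun t => -η t) ε t = correction a b c m lam η ε t := by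
  have : |-η c - -η a| = |η c - η a| := by rw [← abs_neg (η c - η a)]; congr 1; ring
  simp only [correction, psi, this]

/-- Reflection: `-y` solves the problem for `-F t (-x)` with reduced solution `-η`, while `ζ̂` and
`v` are unchanged. -/
theorem solution_bounds_of_nonpos (hac : a < c) (hcb : c < b) (hε : 0 < ε) (hlam : 0 ≤ lam)
    (hmk : m = -k - lam) (hm : 0 < m)
    (hL : ∀ t ∈ Icc a b, ∀ x y, |F t x - F t y| ≤ lam * |x - y|)
    (hη : HasSecondDerivOn η η₂ (Ioo a b)) (hηc : ContinuousOn η (Icc a b))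
    (hC : ∀ t ∈ Ioo a b, |η₂ t| ≤ m * C) (hηF : ∀ t ∈ Icc a b, F t (η t) = k * η t)
    (hy : HasSecondDerivOn y y₂ (Ioo a b)) (hyc : ContinuousOn y (Icc a b))
    (hyF : ∀ t ∈ Icc a b, ε * y₂ t + k * y t = F t (y t)) (hya : y a = y c) (hyb : y b = y c)
    (hΔ : η c - η a ≤ 0) {t : ℝ} (ht : t ∈ Icc a b) :
    η t + zeta a b c m η ε t - zetaHat a b c m η ε t - C * ε ≤ y t ∧
    y t ≤ η t + zetaHat a b c m η ε t + C * ε ∧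
    y t ≤ η t + zeta a b c m η ε t + correction a b c m lam η ε t + zetaHat a b c m η ε t
      + C * ε := by
  have := solution_bounds_of_nonneg (F := fun t x => -F t (-x)) (η := fun t => -η t)
    (y := fun t => -y t) (C := C) hac hcb hε hlam hmk hm
    (fun t ht x y => by
      have := hL t ht (-x) (-y)
      rw [← abs_neg, ← abs_neg (x - y)]
      convert this using 2 <;> ring_nf) hη.neg hηc.neg
    (fun t ht => by simpa using hC t ht) (fun t ht => by simp [hηF t ht]) hy.neg hyc.neg
    (fun t ht => by simp only [neg_neg]; linarith [hyF t ht]) (by simp [hya]) (by simp [hyb])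
    (by linarith) ht
  rw [zeta_neg, zetaHat_neg, correction_neg] at this
  obtain ⟨h1, h2, h3⟩ := this
  refine ⟨?_, ?_, ?_⟩ <;> linarith

/-- An a priori bound without `v` and independent of `F`, hence uniform in the control. -/
theorem abs_solution_sub_le (hac : a < c) (hcb : c < b) (hε : 0 < ε) (hlam : 0 ≤ lam)
    (hmk : m = -k - lam) (hm : 0 < m)
    (hL : ∀ t ∈ Icc a b, ∀ x y, |F t x - F t y| ≤ lam * |x - y|)
    (hη : HasSecondDerivOn η η₂ (Ioo a b)) (hηc : ContinuousOn η (Icc a b))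
    (hC : ∀ t ∈ Ioo a b, |η₂ t| ≤ m * C) (hηF : ∀ t ∈ Icc a b, F t (η t) = k * η t)
    (hy : HasSecondDerivOn y y₂ (Ioo a b)) (hyc : ContinuousOn y (Icc a b))
    (hyF : ∀ t ∈ Icc a b, ε * y₂ t + k * y t = F t (y t)) (hya : y a = y c) (hyb : y b = y c)
    {t : ℝ} (ht : t ∈ Icc a b) :
    |y t - η t| ≤ |η c - η a| * layerShape a b c m ε t + |η b - η c| * layerShapeHat a b c m ε t
      + C * ε := by
  have hZ := layerShape_pos hac hcb hm hε t
  have h0 : 0 ≤ |η c - η a| * layerShape a b c m ε t := by positivity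
  rcases le_total 0 (η c - η a) with hΔ | hΔ
  · obtain ⟨h1, h2, -⟩ := solution_bounds_of_nonneg hac hcb hε hlam hmk hm hL hη hηc hC hηF hy hyc
      hyF hya hyb hΔ ht
    rw [abs_of_nonneg hΔ] at h0 ⊢
    rw [zetaHat, zeta] at h1
    rw [zetaHat] at h2
    exact abs_le.2 ⟨by linarith, by linarith⟩
  · obtain ⟨h1, h2, -⟩ := solution_bounds_of_nonpos hac hcb hε hlam hmk hm hL hη hηc hC hηF hy hyc
      hyF hya hyb hΔ ht
    rw [abs_of_nonpos hΔ] at h0 ⊢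
    rw [zetaHat, zeta] at h1
    rw [zetaHat] at h2
    exact abs_le.2 ⟨by linarith, by linarith⟩

end Estimates

/-! ### Layers and correction as `ε → 0⁺` -/

section Asymptotics

variable {a b c m : ℝ}

theorem tendsto_sqrt_div_atTop (hm : 0 < m) :
    Tendsto (fun ε : ℝ => √(m / ε)) (𝓝[>] 0) atTop := by
  refine Real.tendsto_sqrt_atTop.comp ?_
  exact (tendsto_inv_nhdsGT_zero.const_mul_atTop hm).congr fun x => (div_eq_mul_inv m x).symm

theorem tendsto_exp_sqrt_mul (hm : 0 < m) {r : ℝ} (hr : r < 0) :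
    Tendsto (fun ε : ℝ => Real.exp (√(m / ε) * r)) (𝓝[>] 0) (𝓝 0) :=
  Real.tendsto_exp_atBot.comp ((tendsto_sqrt_div_atTop hm).atTop_mul_const_of_neg hr)

/-- The ratio of the dominant exponential of the denominator to the denominator. -/
noncomputable def layerRatio (a b c m ε : ℝ) : ℝ :=
  Real.exp (√(m / ε) * (b - a)) / layerD a b c m ε

theorem tendsto_layerRatio (hac : a < c) (hcb : c < b) (hm : 0 < m) :
    Tendsto (layerRatio a b c m) (𝓝[>] 0) (𝓝 1) := by
  have h := (((((tendsto_const_nhds (x := (1 : ℝ))).add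
    (tendsto_exp_sqrt_mul hm (r := c - b - (b - a)) (by linarith))).add
    (tendsto_exp_sqrt_mul hm (r := a - c - (b - a)) (by linarith))).sub
    (tendsto_exp_sqrt_mul hm (r := a - b - (b - a)) (by linarith))).sub
    (tendsto_exp_sqrt_mul hm (r := b - c - (b - a)) (by linarith))).sub
    (tendsto_exp_sqrt_mul hm (r := c - a - (b - a)) (by linarith))
  have h' := h.inv₀ (by norm_num)
  refine (h'.congr fun ε => ?_).trans (by norm_num)
  simp only [mul_sub (√(m / ε)) _ (b - a), Real.exp_sub]
  rw [layerRatio, layerD, ← inv_div]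
  have := (Real.exp_pos (√(m / ε) * (b - a))).ne'
  field_simp
  ring

/-- The negative exponentials are dropped and `e^{s(b-a)}` is factored out, with `t - c ≤ b - c`. -/
theorem layerShape_le (hac : a < c) (hcb : c < b) (hm : 0 < m) {ε : ℝ} (hε : 0 < ε) {t : ℝ}
    (ht : t ≤ b) : layerShape a b c m ε t ≤
      (Real.exp (√(m / ε) * (a - t)) + Real.exp (√(m / ε) * (a - c))) * layerRatio a b c m ε := by
  rw [layerRatio, layerShape, ← mul_div_assoc]
  refine div_le_div_of_nonneg_right ?_ (layerD_pos hac hcb hm hε).le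
  rw [add_mul, ← Real.exp_add, ← Real.exp_add]
  have h1 : √(m / ε) * (a - t) + √(m / ε) * (b - a) = √(m / ε) * (b - t) := by ring
  have h2 : √(m / ε) * (t - c) ≤ √(m / ε) * (a - c) + √(m / ε) * (b - a) := by
    rw [← mul_add]
    exact mul_le_mul_of_nonneg_left (by linarith) (Real.sqrt_nonneg _)
  have h3 := Real.exp_le_exp.2 h2
  rw [h1]
  linarith [Real.exp_pos (√(m / ε) * (t - b)), Real.exp_pos (√(m / ε) * (c - t))]

theorem layerShapeHat_le (hac : a < c) (hcb : c < b) (hm : 0 < m) {ε : ℝ} (hε : 0 < ε) {t : ℝ}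
    (ht : a ≤ t) : layerShapeHat a b c m ε t ≤
      (Real.exp (√(m / ε) * (t - b)) + Real.exp (√(m / ε) * (c - b))) * layerRatio a b c m ε := by
  rw [layerRatio, layerShapeHat, ← mul_div_assoc]
  refine div_le_div_of_nonneg_right ?_ (layerD_pos hac hcb hm hε).le
  rw [add_mul, ← Real.exp_add, ← Real.exp_add]
  have h1 : √(m / ε) * (t - b) + √(m / ε) * (b - a) = √(m / ε) * (t - a) := by ring
  have h2 : √(m / ε) * (c - t) ≤ √(m / ε) * (c - b) + √(m / ε) * (b - a) := by
    rw [← mul_add]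
    exact mul_le_mul_of_nonneg_left (by linarith) (Real.sqrt_nonneg _)
  have h3 := Real.exp_le_exp.2 h2
  rw [h1]
  linarith [Real.exp_pos (√(m / ε) * (a - t)), Real.exp_pos (√(m / ε) * (t - c))]

/-- For small `ε` the layers, of heights `A` and `B`, fit into any tube whose half-width exceeds
`A` near `a` and `B` near `b`. -/
theorem eventually_layers_lt (hac : a < c) (hcb : c < b) (hm : 0 < m) {A B C σ τ : ℝ}
    (hA : 0 ≤ A) (hB : 0 ≤ B) (hσ : 0 < σ) (hτ : 0 < τ) {d : ℝ → ℝ}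
    (hd : ∀ t ∈ Icc a b, 2 * τ ≤ d t) (hda : ∀ t ∈ Icc a b, t ≤ a + σ → A + 2 * τ ≤ d t)
    (hdb : ∀ t ∈ Icc a b, b - σ ≤ t → B + 2 * τ ≤ d t) :
    ∀ᶠ ε in 𝓝[>] (0 : ℝ), ∀ t ∈ Icc a b,
      A * layerShape a b c m ε t + B * layerShapeHat a b c m ε t + C * ε < d t - τ := by
  -- Then a point within `σ` of one endpoint is at distance at least `σ` from the other.
  wlog hσ' : σ ≤ (b - a) / 2 generalizing σ
  · exact this (σ := min σ ((b - a) / 2)) (lt_min hσ (by linarith))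
      (fun t ht h => hda t ht (h.trans (by linarith [min_le_left σ ((b - a) / 2)])))
      (fun t ht h => hdb t ht (le_trans (by linarith [min_le_left σ ((b - a) / 2)]) h))
      (min_le_right _ _)
  have hid : Tendsto (fun ε : ℝ => ε) (𝓝[>] 0) (𝓝 0) := tendsto_nhdsWithin_of_tendsto_nhds tendsto_id
  have hR := tendsto_layerRatio hac hcb hm
  have e0 := tendsto_exp_sqrt_mul hm (r := -σ) (by linarith)
  have e1 := tendsto_exp_sqrt_mul hm (r := a - c) (by linarith)
  have e2 := tendsto_exp_sqrt_mul hm (r := c - b) (by linarith)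
  -- Bounds on each layer that do not involve `t`: at distance at least `σ` from its endpoint they
  -- tend to 0, elsewhere to the full height `A` or `B`.
  have far1 := (((e0.add e1).mul hR).const_mul A)
  have far2 := (((e0.add e2).mul hR).const_mul B)
  have near1 := (((e1.const_add 1).mul hR).const_mul A)
  have near2 := (((e2.const_add 1).mul hR).const_mul B)
  have l1 := ((near1.add far2).add (hid.const_mul C)).eventually_lt_const
    (show _ < A + τ by simpa using hτ)
  have l2 := ((far1.add far2).add (hid.const_mul C)).eventually_lt_const
    (show _ < τ by simpa using hτ)
  have l3 := ((far1.add near2).add (hid.const_mul C)).eventually_lt_const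
    (show _ < B + τ by simpa using hτ)
  filter_upwards [l1, l2, l3, self_mem_nhdsWithin] with ε l1 l2 l3 hε t ht
  have hε : 0 < ε := hε
  have hR0 : 0 ≤ layerRatio a b c m ε :=
    div_nonneg (Real.exp_pos _).le (layerD_pos hac hcb hm hε).le
  have hexp {x y : ℝ} (h : x ≤ y) : Real.exp (√(m / ε) * x) ≤ Real.exp (√(m / ε) * y) :=
    Real.exp_le_exp.2 (mul_le_mul_of_nonneg_left h (Real.sqrt_nonneg _))
  have hZ {x : ℝ} (h : Real.exp (√(m / ε) * (a - t)) ≤ x) : A * layerShape a b c m ε t ≤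
      A * ((x + Real.exp (√(m / ε) * (a - c))) * layerRatio a b c m ε) :=
    mul_le_mul_of_nonneg_left ((layerShape_le hac hcb hm hε ht.2).trans
      (mul_le_mul_of_nonneg_right (by linarith) hR0)) hA
  have hZh {x : ℝ} (h : Real.exp (√(m / ε) * (t - b)) ≤ x) : B * layerShapeHat a b c m ε t ≤
      B * ((x + Real.exp (√(m / ε) * (c - b))) * layerRatio a b c m ε) :=
    mul_le_mul_of_nonneg_left ((layerShapeHat_le hac hcb hm hε ht.1).trans
      (mul_le_mul_of_nonneg_right (by linarith) hR0)) hB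
  have hone {x : ℝ} (h : x ≤ 0) : Real.exp (√(m / ε) * x) ≤ 1 := by simpa using hexp h
  rcases le_total t (a + σ) with h1 | h1
  · have := hda t ht h1
    have := hZ (hone (by linarith [ht.1]))
    have := hZh (hexp (x := t - b) (y := -σ) (by linarith))
    linarith
  rcases le_total (b - σ) t with h2 | h2
  · have := hdb t ht h2
    have := hZ (hexp (x := a - t) (y := -σ) (by linarith))
    have := hZh (hone (by linarith [ht.2]))
    linarith
  · have := hd t ht
    have := hZ (hexp (x := a - t) (y := -σ) (by linarith))
    have := hZh (hexp (x := t - b) (y := -σ) (by linarith))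
    linarith

/-- Left of `(b + c) / 2` the dominant term of the numerator is `e^{s(b-t)}`, right of it
`-e^{s(t-c)}`; division by `e^{s(b-a)}` yields the two branches of `chi`. -/
theorem tendsto_layerCosh_div_exp_chi (hac : a < c) (hcb : c < b) (hm : 0 < m) {t : ℝ}
    (ht : t ≠ (b + c) / 2) :
    Tendsto (fun ε => layerCosh a b c m ε t / Real.exp (√(m / ε) * chi a b c t)) (𝓝[>] 0)
      (𝓝 (if t ≤ (b + c) / 2 then 1 else -1)) := by
  have hR := tendsto_layerRatio hac hcb hm
  rcases lt_or_gt_of_ne ht with h | h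
  · rw [if_pos h.le, chi, if_pos h.le]
    have l := ((((tendsto_exp_sqrt_mul hm (r := 2 * (t - b)) (by linarith)).const_add 1).sub
      (tendsto_exp_sqrt_mul hm (r := c - b) (by linarith))).sub
      (tendsto_exp_sqrt_mul hm (r := 2 * t - c - b) (by linarith))).mul hR
    refine (l.congr fun ε => ?_).trans (by norm_num)
    rw [eq_div_iff (Real.exp_ne_zero _), layerRatio, layerCosh]
    have e1 : √(m / ε) * (b - t) = √(m / ε) * (b - a) + √(m / ε) * (a - t) := by ring
    have e2 : √(m / ε) * (t - b) =
        √(m / ε) * (2 * (t - b)) + √(m / ε) * (b - a) + √(m / ε) * (a - t) := by ring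
    have e3 : √(m / ε) * (c - t) =
        √(m / ε) * (c - b) + √(m / ε) * (b - a) + √(m / ε) * (a - t) := by ring
    have e4 : √(m / ε) * (t - c) =
        √(m / ε) * (2 * t - c - b) + √(m / ε) * (b - a) + √(m / ε) * (a - t) := by ring
    rw [e1, e2, e3, e4]
    simp only [Real.exp_add]
    ring
  · rw [if_neg (not_le.2 h), chi, if_neg (not_le.2 h)]
    have l := ((((tendsto_exp_sqrt_mul hm (r := b + c - 2 * t) (by linarith)).add
      (tendsto_exp_sqrt_mul hm (r := c - b) (by linarith))).sub
      (tendsto_exp_sqrt_mul hm (r := 2 * (c - t)) (by linarith))).sub_const 1).mul hR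
    refine (l.congr fun ε => ?_).trans (by norm_num)
    rw [eq_div_iff (Real.exp_ne_zero _), layerRatio, layerCosh]
    have e1 : √(m / ε) * (b - t) =
        √(m / ε) * (b + c - 2 * t) + √(m / ε) * (b - a) + √(m / ε) * (t - b + a - c) := by ring
    have e2 : √(m / ε) * (t - b) =
        √(m / ε) * (c - b) + √(m / ε) * (b - a) + √(m / ε) * (t - b + a - c) := by ring
    have e3 : √(m / ε) * (c - t) =
        √(m / ε) * (2 * (c - t)) + √(m / ε) * (b - a) + √(m / ε) * (t - b + a - c) := by ring
    have e4 : √(m / ε) * (t - c) =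
        √(m / ε) * (b - a) + √(m / ε) * (t - b + a - c) := by ring
    rw [e1, e2, e3, e4]
    simp only [Real.exp_add]
    ring

/-- Here the dominant exponentials cancel identically, so the exact order fails while the upper
bound is trivial. -/
theorem layerCosh_midpoint (a b c m ε : ℝ) : layerCosh a b c m ε ((b + c) / 2) = 0 := by
  have e1 : b - (b + c) / 2 = (b + c) / 2 - c := by ring
  have e2 : c - (b + c) / 2 = (b + c) / 2 - b := by ring
  rw [layerCosh, e1, e2]
  ring

theorem chi_neg (hac : a < c) {t : ℝ} (ht : t ∈ Ioc a b) : chi a b c t < 0 := by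
  rw [chi]
  split_ifs
  · linarith [ht.1]
  · linarith [ht.2]

theorem sameOrder_of_tendsto_div {s r : ℝ → ℝ} {L : ℝ} (hL : L ≠ 0)
    (h : Tendsto (fun ε => s ε / r ε) (𝓝[>] 0) (𝓝 L)) : SameOrder s r :=
  ⟨|L|, abs_pos.2 hL, h.abs⟩

theorem isBigO_exp_of_tendsto_div {s g : ℝ → ℝ} {L : ℝ}
    (h : Tendsto (fun ε => s ε / Real.exp (g ε)) (𝓝[>] 0) (𝓝 L)) :
    s =O[𝓝[>] 0] fun ε => Real.exp (g ε) :=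
  isBigO_of_div_tendsto_nhds (Eventually.of_forall fun _ h => absurd h (Real.exp_ne_zero _)) L h

theorem correction_expansion (hac : a < c) (hcb : c < b) (hm : 0 < m) (lam : ℝ) (η : ℝ → ℝ) :
    ∃ (θ₁ θ₂ : ℝ → ℝ) (θ₃ : ℝ → ℝ → ℝ),
      (∀ ε : ℝ, 0 < ε → ∀ t ∈ Icc a b,
        correction a b c m lam η ε t = lam * |η c - η a| / √(m * ε) *
          (-θ₁ ε * layerShape a b c m ε t + θ₂ ε * layerShapeHat a b c m ε t + t * θ₃ t ε)) ∧
      (θ₁ =O[𝓝[>] 0] fun _ : ℝ => (1 : ℝ)) ∧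
      (a ≠ 0 → SameOrder θ₁ fun _ => 1) ∧
      (θ₂ =O[𝓝[>] 0] fun ε : ℝ => Real.exp (√(m / ε) * (a - c))) ∧
      (b + c ≠ 0 → SameOrder θ₂ fun ε => Real.exp (√(m / ε) * (a - c))) ∧
      ∀ t ∈ Icc a b,
        (θ₃ t =O[𝓝[>] 0] fun ε : ℝ => Real.exp (√(m / ε) * chi a b c t)) ∧
        (t ≠ (b + c) / 2 → SameOrder (θ₃ t) fun ε => Real.exp (√(m / ε) * chi a b c t)) := by
  have ha := tendsto_layerCosh_div_exp_chi hac hcb hm (t := a) (by linarith)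
  have hc := tendsto_layerCosh_div_exp_chi hac hcb hm (t := c) (by linarith)
  have hb := tendsto_layerCosh_div_exp_chi hac hcb hm (t := b) (by linarith)
  have ca : chi a b c a = 0 := by rw [chi, if_pos (by linarith), sub_self]
  have cc : chi a b c c = a - c := by rw [chi, if_pos (by linarith)]
  have cb : chi a b c b = a - c := by rw [chi, if_neg (by linarith)]; ring
  rw [ca, if_pos (by linarith)] at ha
  rw [cc, if_pos (by linarith)] at hc
  rw [cb, if_neg (by linarith)] at hb
  have h1 : Tendsto (fun ε => a * layerCosh a b c m ε a - c * layerCosh a b c m ε c) (𝓝[>] 0)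
      (𝓝 a) := by
    have h := (ha.const_mul a).sub
      ((hc.mul (tendsto_exp_sqrt_mul hm (r := a - c) (by linarith))).const_mul c)
    simpa [div_mul_cancel₀] using h
  -- Both `c` and `b` have exponent `a - c` but lie on opposite sides of the midpoint, so the limits
  -- `1` and `-1` combine to `c + b`.
  have h2 : Tendsto (fun ε => (c * layerCosh a b c m ε c - b * layerCosh a b c m ε b) /
      Real.exp (√(m / ε) * (a - c))) (𝓝[>] 0) (𝓝 (b + c)) := by
    refine (((hc.const_mul c).sub (hb.const_mul b)).congr fun ε => ?_).trans
      (by rw [mul_one, mul_neg_one, sub_neg_eq_add, add_comm])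
    ring
  refine ⟨fun ε => a * layerCosh a b c m ε a - c * layerCosh a b c m ε c,
    fun ε => c * layerCosh a b c m ε c - b * layerCosh a b c m ε b,
    fun t ε => layerCosh a b c m ε t, fun ε _ t _ => ?_, h1.isBigO_one ℝ,
    fun h => sameOrder_of_tendsto_div h (by simpa using h1), isBigO_exp_of_tendsto_div h2,
    fun h => sameOrder_of_tendsto_div h h2, fun t _ => ⟨?_, fun h => ?_⟩⟩
  · rw [correction]
    simp only [psi_eq]
    ring
  · by_cases h : t = (b + c) / 2
    · simp only [h, layerCosh_midpoint]
      exact isBigO_zero _ _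
    · exact isBigO_exp_of_tendsto_div (tendsto_layerCosh_div_exp_chi hac hcb hm h)
  · refine sameOrder_of_tendsto_div ?_ (tendsto_layerCosh_div_exp_chi hac hcb hm h)
    split_ifs <;> norm_num

end Asymptotics

/-! ### Solutions in the tube and extension of the right-hand side -/

section Tube

variable {a b c k lam ε : ℝ} {η d : ℝ → ℝ} {f : ℝ → ℝ → ℝ} {u : ℝ → ℝ}

/-- Each fibre of the tube is an interval, so the mean value inequality applies in `y`. -/
theorem HasBoundedSlope.abs_sub_le (hf : HasBoundedSlope (tube a b η d) lam f u) {t : ℝ}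
    (ht : t ∈ Icc a b) {x y : ℝ} (hx : |x - η t| < d t) (hy : |y - η t| < d t) :
    |f (u t) x - f (u t) y| ≤ lam * |x - y| := by
  have := Convex.norm_image_sub_le_of_norm_deriv_le (𝕜 := ℝ) (f := f (u t)) (C := lam)
    (s := Metric.ball (η t) (d t)) (x := y) (y := x)
    (fun z hz => hf.differentiableAt (t, z) ⟨ht, by simpa [Real.dist_eq] using hz⟩)
    (fun z hz => hf.bound (t, z) ⟨ht, by simpa [Real.dist_eq] using hz⟩)
    (convex_ball _ _) (by simpa [Real.dist_eq] using hy) (by simpa [Real.dist_eq] using hx)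
  simpa [Real.norm_eq_abs] using this

/-- Both graphs lie in the tube, so comparison uses `f` itself; exchanging `y` and `z` gives
uniqueness. -/
theorem IsSolutionIn.le (hac : a < c) (hcb : c < b) (hε : 0 < ε) (hlamk : lam < -k)
    (hf : HasBoundedSlope (tube a b η d) lam f u) {y z : ℝ → ℝ}
    (hy : IsSolutionIn (tube a b η d) a b c k ε f u y)
    (hz : IsSolutionIn (tube a b η d) a b c k ε f u z) {t : ℝ} (ht : t ∈ Icc a b) :
    y t ≤ z t := by
  refine threePoint_comparison (F := fun t => f (u t)) hac hcb hε hlamk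
    (fun x hx => hf.abs_sub_le (Ioo_subset_Icc_self hx) (hy.mem x (Ioo_subset_Icc_self hx)).2
      (hz.mem x (Ioo_subset_Icc_self hx)).2)
    (.of_contDiffOn hy.contDiffOn) hy.contDiffOn.continuousOn
    (.of_contDiffOn hz.contDiffOn) hz.contDiffOn.continuousOn
    (fun x hx => (hy.ode x (Ioo_subset_Icc_self hx)).ge)
    (fun x hx => (hz.ode x (Ioo_subset_Icc_self hx)).le) ?_ ?_ ht
  · rw [hy.bc_left, hz.bc_left]
  · rw [hy.bc_right, hz.bc_right]

/-- The restriction of the right-hand side to a closed subtube extends to a globally Lipschitz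
function. -/
theorem HasBoundedSlope.exists_extension (hab : a ≤ b) (hlam : 0 ≤ lam)
    (hf : HasBoundedSlope (tube a b η d) lam f u) (hη : ContinuousOn η (Icc a b)) {r : ℝ → ℝ}
    (hr : ContinuousOn r (Icc a b)) (hr0 : ∀ t ∈ Icc a b, 0 ≤ r t)
    (hrd : ∀ t ∈ Icc a b, r t < d t) :
    ∃ F : ℝ → ℝ → ℝ, (Continuous fun q : ℝ × ℝ => F q.1 q.2) ∧
      (∀ t ∈ Icc a b, ∀ x y, |F t x - F t y| ≤ lam * |x - y|) ∧
      ∀ t ∈ Icc a b, ∀ x, |x - η t| ≤ r t → F t x = f (u t) x := by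
  let π (t : ℝ) : ℝ := projIcc a b hab t
  have hπ (t : ℝ) : π t ∈ Icc a b := (projIcc a b hab t).2
  have hπc : Continuous π := continuous_subtype_val.comp continuous_projIcc
  have hπt {t : ℝ} (ht : t ∈ Icc a b) : π t = t := by simp only [π, projIcc_of_mem hab ht]
  have hηc : Continuous fun t => η (π t) := hη.comp_continuous hπc hπ
  have hrc : Continuous fun t => r (π t) := hr.comp_continuous hπc hπ
  -- `P t` clamps `x` to `[η - r, η + r]`, evaluated at `π t`; it is 1-Lipschitz in `x` and fixes
  -- the closed subtube.
  let P (t x : ℝ) : ℝ := η (π t) + max (-r (π t)) (min (x - η (π t)) (r (π t)))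
  have hPc : Continuous fun q : ℝ × ℝ => P q.1 q.2 := by
    have h1 : Continuous fun q : ℝ × ℝ => η (π q.1) := hηc.comp continuous_fst
    have h2 : Continuous fun q : ℝ × ℝ => r (π q.1) := hrc.comp continuous_fst
    exact h1.add (h2.neg.max ((continuous_snd.sub h1).min h2))
  have hPd (t x : ℝ) : |P t x - η (π t)| < d (π t) := by
    have h1 := hr0 _ (hπ t)
    have h2 := hrd _ (hπ t)
    rw [add_sub_cancel_left]
    refine (abs_le.2 ⟨le_max_left _ _, max_le (by linarith) (min_le_right _ _)⟩).trans_lt h2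
  have hPL (t x y : ℝ) : |P t x - P t y| ≤ |x - y| := by
    rw [add_sub_add_left_eq_sub, max_comm, max_comm (-r (π t))]
    refine (abs_max_sub_max_le_abs _ _ _).trans ((abs_min_sub_min_le_max _ _ _ _).trans ?_)
    simp
  refine ⟨fun t x => f (u (π t)) (P t x), ?_, fun t _ x y => ?_, fun t ht x hx => ?_⟩
  · exact hf.continuousOn.comp_continuous ((hπc.comp continuous_fst).prodMk hPc)
      fun q => ⟨hπ _, hPd _ _⟩
  · exact (hf.abs_sub_le (hπ t) (hPd t x) (hPd t y)).trans
      (mul_le_mul_of_nonneg_left (hPL t x y) hlam)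
  · have h := abs_le.1 hx
    simp only [P, hπt ht]
    rw [min_eq_left h.2, max_eq_right h.1, add_sub_cancel]

end Tube

/-! ### Error constant, margin and the main theorem -/

theorem abs_iteratedDerivWithin_le_errorConst {a b m : ℝ} {η : ℝ → ℝ} (hab : a < b) (hm : 0 < m)
    (hη : ContDiffOn ℝ 2 η (Icc a b)) {t : ℝ} (ht : t ∈ Icc a b) :
    |iteratedDerivWithin 2 η (Icc a b) t| ≤ m * errorConst a b m η := by
  have hc := (hη.continuousOn_iteratedDerivWithin (m := 2) le_rfl (uniqueDiffOn_Icc hab)).abs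
  rw [errorConst, ← mul_assoc, mul_one_div_cancel hm.ne', one_mul]
  exact le_csSup (isCompact_Icc.image_of_continuousOn hc).bddAbove (mem_image_of_mem _ ht)

/-- A uniform margin for the tube. -/
theorem IsTubeWidth.exists_margin {a b c δ : ℝ} {η d : ℝ → ℝ} (hab : a ≤ b) (hδ : 0 < δ)
    (hd : IsTubeWidth a b c η δ d) :
    ∃ τ : ℝ, 0 < τ ∧ (∀ t ∈ Icc a b, 2 * τ ≤ d t) ∧
      (∀ t ∈ Icc a b, t ≤ a + δ / 2 → |η c - η a| + 2 * τ ≤ d t) ∧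
      (∀ t ∈ Icc a b, b - δ / 2 ≤ t → |η b - η c| + 2 * τ ≤ d t) := by
  obtain ⟨x, hx, hmin⟩ := isCompact_Icc.exists_isMinOn ⟨a, left_mem_Icc.2 hab⟩ hd.continuousOn
  have h1 := min_le_left (d x) δ
  have h2 := min_le_right (d x) δ
  -- `d x` is the minimum of `d`. The factor 2 in the margin leaves one `τ` for shrinking the tube
  -- and one for the excess of the subtube over the layer heights.
  refine ⟨min (d x) δ / 2, half_pos (lt_min (hd.pos x hx) hδ), fun t ht => ?_,
    fun t ht h => ?_, fun t ht h => ?_⟩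
  · have : d x ≤ d t := hmin ht
    linarith
  · rw [hd.left t ht h]
    linarith
  · rw [hd.right t ht h]
    linarith

theorem theorem1 (a b c k lam δ : ℝ) (hac : a < c) (hcb : c < b) (hk : k < 0)
    (hlam : 0 ≤ lam) (hlamk : lam < -k) (hδ : 0 < δ)
    (η d : ℝ → ℝ) (hη : ContDiffOn ℝ 2 η (Icc a b)) (hd : IsTubeWidth a b c η δ d)
    (f : ℝ → ℝ → ℝ) (m C : ℝ) (hm : m = -k - lam) (hC : C = errorConst a b m η) :
    (∃ ε₀ : ℝ, 0 < ε₀ ∧ ∀ ε : ℝ, 0 < ε → ε ≤ ε₀ → ∀ u : ℝ → ℝ,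
      SolvesReduced a b k f u η → HasBoundedSlope (tube a b η d) lam f u →
      ∃ y : ℝ → ℝ, IsSolutionIn (tube a b η d) a b c k ε f u y ∧
        (∀ z : ℝ → ℝ, IsSolutionIn (tube a b η d) a b c k ε f u z → EqOn z y (Icc a b)) ∧
        (0 ≤ η c - η a → ∀ t ∈ Icc a b,
          -correction a b c m lam η ε t - zetaHat a b c m η ε t - C * ε
              ≤ y t - (η t + zeta a b c m η ε t) ∧
            y t - (η t + zeta a b c m η ε t) ≤ zetaHat a b c m η ε t + C * ε) ∧
        (η c - η a ≤ 0 → ∀ t ∈ Icc a b,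
          -zetaHat a b c m η ε t - C * ε ≤ y t - (η t + zeta a b c m η ε t) ∧
            y t - (η t + zeta a b c m η ε t)
              ≤ correction a b c m lam η ε t + zetaHat a b c m η ε t + C * ε)) ∧
    (∀ ε : ℝ, 0 < ε →
      (∀ t ∈ Icc a b, 0 ≤ correction a b c m lam η ε t ∧
        (lam ≠ 0 → η c ≠ η a → 0 < correction a b c m lam η ε t)) ∧
      correction a b c m lam η ε a = correction a b c m lam η ε c) ∧
    (∀ t ∈ Ioc a b, chi a b c t < 0) ∧
    (∃ (θ₁ θ₂ : ℝ → ℝ) (θ₃ : ℝ → ℝ → ℝ),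
      (∀ ε : ℝ, 0 < ε → ∀ t ∈ Icc a b,
        correction a b c m lam η ε t = lam * |η c - η a| / √(m * ε) *
          (-θ₁ ε * layerShape a b c m ε t + θ₂ ε * layerShapeHat a b c m ε t + t * θ₃ t ε)) ∧
      (θ₁ =O[𝓝[>] 0] fun _ : ℝ => (1 : ℝ)) ∧
      (a ≠ 0 → SameOrder θ₁ fun _ => 1) ∧
      (θ₂ =O[𝓝[>] 0] fun ε : ℝ => Real.exp (√(m / ε) * (a - c))) ∧
      (b + c ≠ 0 → SameOrder θ₂ fun ε => Real.exp (√(m / ε) * (a - c))) ∧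
      ∀ t ∈ Icc a b,
        (θ₃ t =O[𝓝[>] 0] fun ε : ℝ => Real.exp (√(m / ε) * chi a b c t)) ∧
        (t ≠ (b + c) / 2 → SameOrder (θ₃ t) fun ε => Real.exp (√(m / ε) * chi a b c t))) := by
  have hab : a < b := hac.trans hcb
  have hm0 : 0 < m := by linarith
  refine ⟨?_, fun ε hε => ⟨fun t ht => ⟨correction_nonneg hac hcb hm0 hε hlam ht, fun hl hne =>
    correction_pos hac hcb hm0 hε (lt_of_le_of_ne hlam (Ne.symm hl)) hne ht⟩,
    threePointAdjust_left hac hcb hm0 hε _⟩, fun t ht => chi_neg hac ht,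
    correction_expansion hac hcb hm0 lam η⟩
  obtain ⟨τ, hτ, hdτ, hda, hdb⟩ := hd.exists_margin hab.le hδ
  -- The threshold is fixed before the control is introduced.
  obtain ⟨ε₀, hε₀, hsmall⟩ := mem_nhdsGT_iff_exists_Ioc_subset.1
    (eventually_layers_lt (C := C) hac hcb hm0 (abs_nonneg (η c - η a)) (abs_nonneg (η b - η c))
      (half_pos hδ) hτ hdτ hda hdb)
  refine ⟨ε₀, hε₀, fun ε hε hεε₀ u hu hf => ?_⟩
  have hlt := hsmall ⟨hε, hεε₀⟩
  have hηc := hη.continuousOn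
  obtain ⟨F, hFc, hFL, hFf⟩ := hf.exists_extension (r := fun t => d t - τ) hab.le hlam hηc
    (hd.continuousOn.sub continuousOn_const) (fun t ht => by linarith [hdτ t ht])
    (fun t _ => by linarith)
  obtain ⟨y, y₂, hy, hy₂c, hyF, hya, hyb⟩ :=
    exists_threePoint_of_lipschitz hac hcb hlam hlamk hε hFc hFL
  have hη₂ : ∀ t ∈ Ioo a b, |iteratedDerivWithin 2 η (Icc a b) t| ≤ m * C := fun t ht =>
    hC ▸ abs_iteratedDerivWithin_le_errorConst hab hm0 hη (Ioo_subset_Icc_self ht)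
  have hηF : ∀ t ∈ Icc a b, F t (η t) = k * η t := fun t ht => by
    rw [hFf t ht _ (by simp only [sub_self, abs_zero]; linarith [hdτ t ht]), hu t ht]
  have hyo := hy.mono (subset_univ (Ioo a b))
  have hη' := HasSecondDerivOn.of_contDiffOn hη
  -- The solution of the extended problem stays in the subtube where `F` agrees with `f`, so it
  -- solves the original problem.
  have hclose : ∀ t ∈ Icc a b, |y t - η t| < d t - τ := fun t ht =>
    (abs_solution_sub_le hac hcb hε hlam hm hm0 hFL hη' hηc hη₂ hηF hyo
      hy.continuous.continuousOn hyF hya hyb ht).trans_lt (hlt t ht)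
  have hsol : IsSolutionIn (tube a b η d) a b c k ε f u y :=
    { contDiffOn := (hy.contDiff hy₂c).contDiffOn
      ode := fun t ht => by
        rw [hy.iteratedDerivWithin_eq hab hy₂c ht, hyF t ht, hFf t ht _ (hclose t ht).le]
      bc_left := hya
      bc_right := hyb.symm
      mem := fun t ht => ⟨ht, (hclose t ht).trans (by linarith)⟩ }
  refine ⟨y, hsol, fun z hz t ht => le_antisymm (hz.le hac hcb hε hlamk hf hsol ht)
    (hsol.le hac hcb hε hlamk hf hz ht), fun hΔ t ht => ?_, fun hΔ t ht => ?_⟩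
  · obtain ⟨h1, -, h3⟩ := solution_bounds_of_nonneg hac hcb hε hlam hm hm0 hFL hη' hηc hη₂ hηF
      hyo hy.continuous.continuousOn hyF hya hyb hΔ ht
    constructor <;> linarith
  · obtain ⟨h1, -, h3⟩ := solution_bounds_of_nonpos hac hcb hε hlam hm hm0 hFL hη' hηc hη₂ hηF
      hyo hy.continuous.continuousOn hyF hya hyb hΔ ht
    constructor <;> linarith
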